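/- Let $n$ be the number of modes, $d$ a positive odd integer, $\ell=\sqrt{2\pi/d}$, and $\mathcal H=L^2(\mathbb R^n)$. Write $\mathbf a=(\mathbf a_X,\mathbf a_Z)\in\mathbb R^{2n}$, $[\mathbf a,\mathbf b]=\mathbf a_X\cdot\mathbf b_Z-\mathbf a_Z\cdot\mathbf b_X$, and let $\hat T_{\mathbf a}=e^{i\pi\mathbf a_X\cdot\mathbf a_Z/d}\,e^{-i\ell\mathbf a_X\cdot\hat{\mathbf p}}\,e^{i\ell\mathbf a_Z\cdot\hat{\mathbf q}}$ be the displacement operators, that is, $(\hat T_{\mathbf a}\psi)(\mathbf q)=e^{i\pi\mathbf a_X\cdot\mathbf a_Z/d}\,e^{i\ell\mathbf a_Z\cdot(\mathbf q-\ell\mathbf a_X)}\,\psi(\mathbf q-\ell\mathbf a_X)$. Let $\mathcal A$ be the set of trace-class operators $\hat C$ on $\mathcal H$ with $\sum_{\mathbf a\in\mathbb Z^{2n}}|\mathrm{Tr}(\hat C\hat T_{\mathbf a})|<\infty$. For $\hat C\in\mathcal A$ the Zak-Gross Wigner function is $$W_{\hat C}(\boldsymbol\eta)=\frac1{(2\pi)^n}\sum_{\mathbf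 a\in\mathbb Z^{2n}}e^{i\ell[\mathbf a,\boldsymbol\eta]+i\pi\mathbf a_X\cdot\mathbf a_Z}\,\mathrm{Tr}(\hat C\hat T_{\mathbf a}),\qquad\boldsymbol\eta\in\mathbb R^{2n},$$ which is $d\ell$-periodic in every coordinate. Let $\int d\boldsymbol\eta$ be the integral over $[0,d\ell)^{2n}$ against $d^{-n}$ times Lebesgue measure (total mass $(2\pi)^n$). For $j\in\{0,\dots,d-1\}^n$ let $|j_{\rm GKP}\rangle=\ell^{-n/2}\sum_{\mathbf m\in\mathbb Z^n}|\ell(d\mathbf m+j)\rangle$ (a tempered distribution), $\hat P_{\mathbf 0}=\sum_j|j_{\rm GKP}\rangle\langle j_{\rm GKP}|$, $\hat P_{\mathbf s}=\hat T_{\mathbf s}\hat P_{\mathbf 0}\hat T_{-\mathbf s}$, and let $\int d\mathbf s$ be the integral over $[0,1)^{2n}$ against $\ell^{2n}$ times Lebesgue measure (so that $\int d\mathbf s\,\hat P_{\mathbf s}=\mathbb 1$). The twirl $\mathcal E(\hat C)=\int d\mathbf s\,\hat P_{\mathbf s}\hat C\hat P_{\mathbf s}$ is the bounded operator with $\langle\varphi,\mathcal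 E(\hat C)\psi\rangle=\sum_i\int d\mathbf s\,\langle\varphi|\hat P_{\mathbf s}|\alpha_i\rangle\langle\beta_i|\hat P_{\mathbf s}|\psi\rangle$ for all Schwartz functions $\varphi,\psi$ and every expansion $\hat C=\sum_i|\alpha_i\rangle\langle\beta_i|$ with Schwartz functions $\alpha_i,\beta_i$ and $\sum_i\|\alpha_i\|\|\beta_i\|<\infty$. Then, for all $\hat C,\hat D\in\mathcal A$ and $\boldsymbol\eta\in\mathbb R^{2n}$: 1. (Linearity) $\hat C+\hat D\in\mathcal A$ and $c\,\hat C\in\mathcal A$ for $c\in\mathbb C$, with $W_{\hat C+\hat D}=W_{\hat C}+W_{\hat D}$ and $W_{c\hat C}=c\,W_{\hat C}$. 2. (Reality) $\hat C^\dagger\in\mathcal A$ and $W_{\hat C^\dagger}(\boldsymbol\eta)=W_{\hat C}(\boldsymbol\eta)^*$. 3. (Standardization) $W_{\hat C}$ is integrable and $\int d\boldsymbol\eta\,W_{\hat C}(\boldsymbol\eta)=\mathrm{Tr}(\hat C)$. 4. (Covariance) For all $\mathbf b\in\mathbb R^{2n}$, $\hat T_{\mathbf b}\hat C\hat T_{\mathbf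 b}^\dagger\in\mathcal A$ and $W_{\hat T_{\mathbf b}\hat C\hat T_{\mathbf b}^\dagger}(\boldsymbol\eta)=W_{\hat C}(\boldsymbol\eta-\ell\mathbf b)$. 5. (Traciality) $\mathcal E(\hat C)$ and $\mathcal E(\hat D)$ exist, $\mathcal E(\hat C)\hat D$ and $\hat C\mathcal E(\hat D)$ are trace class, $W_{\hat C}W_{\hat D}$ is integrable, and $$\int d\boldsymbol\eta\,W_{\hat C}(\boldsymbol\eta)W_{\hat D}(\boldsymbol\eta)=\mathrm{Tr}(\mathcal E(\hat C)\hat D)=\mathrm{Tr}(\hat C\,\mathcal E(\hat D))=\tau(\mathcal E(\hat C)\mathcal E(\hat D)).$$ Here $\tau$ is the trace per stabilizer: $\tau(\hat X)=(2\pi/d)^n\sum_{j\in\{0,\dots,d-1\}^n}\langle\chi_j,\hat X\chi_j\rangle$, where $\chi_j=\ell^{-n/2}\mathbf 1_{\ell(j+[0,1)^n)}$. (The vectors $\hat T_{d\mathbf a}\chi_j$, $\mathbf a\in\mathbb Z^{2n}$, form an orthonormal basis of $\mathcal H$; twirled operators commute with all stabilizers $\hat T_{d\mathbf a}$, so that their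 ordinary trace is a sum of infinitely many equal contributions, one for each $\mathbf a$. The normalization is the one with $\tau(\mathcal E(\hat C))=\mathrm{Tr}(\hat C)$.) -/

import Mathlib

open MeasureTheory
open scoped SchwartzMap InnerProductSpace

noncomputable section

namespace ZakGross

/-! ### Phase space -/

/-- Phase-space vectors `a = (a_X, a_Z)` of length `2n`. -/
abbrev Phase (n : ℕ) : Type := (Fin n → ℝ) × (Fin n → ℝ)

/-- The integer lattice `ℤ^{2n}`. -/
abbrev Lattice (n : ℕ) : Type := (Fin n → ℤ) × (Fin n → ℤ)

/-- An integer vector regarded as a real phase-space vector. -/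
def Lattice.toPhase {n : ℕ} (a : Lattice n) : Phase n :=
  (fun i => (a.1 i : ℝ), fun i => (a.2 i : ℝ))

/-- The symplectic form `[a, b] = a_X ⬝ b_Z - a_Z ⬝ b_X`. -/
def symp {n : ℕ} (a b : Phase n) : ℝ := a.1 ⬝ᵥ b.2 - a.2 ⬝ᵥ b.1

/-- The length `ℓ = √(2π/d)`. -/
def ell (d : ℕ) : ℝ := Real.sqrt (2 * Real.pi / d)

/-! ### The Hilbert space of `n` modes and the displacement operators -/

/-- The Hilbert space `L²(ℝⁿ; ℂ)` of `n` modes, in the position representation. -/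
abbrev Modes (n : ℕ) : Type := Lp ℂ 2 (volume : Measure (Fin n → ℝ))

/-- `exp (-i ℓ x ⬝ p̂)` on wave functions: the translation by `ℓ x`. -/
def shiftX {n : ℕ} (d : ℕ) (x : Fin n → ℝ) (f : (Fin n → ℝ) → ℂ) : (Fin n → ℝ) → ℂ :=
  fun q => f (q - ell d • x)

/-- `exp (i ℓ z ⬝ q̂)` on wave functions: the multiplication by `exp (i ℓ z ⬝ q)`. -/
def modZ {n : ℕ} (d : ℕ) (z : Fin n → ℝ) (f : (Fin n → ℝ) → ℂ) : (Fin n → ℝ) → ℂ :=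
  fun q => Complex.exp (Complex.I * ((ell d * (z ⬝ᵥ q) : ℝ) : ℂ)) * f q

/-- The displacement `T_a = exp (i π a_X ⬝ a_Z / d) exp (-i ℓ a_X ⬝ p̂) exp (i ℓ a_Z ⬝ q̂)`
on wave functions. -/
def dispFun {n : ℕ} (d : ℕ) (a : Phase n) (f : (Fin n → ℝ) → ℂ) : (Fin n → ℝ) → ℂ :=
  fun q => Complex.exp (Complex.I * ((Real.pi * (a.1 ⬝ᵥ a.2) / d : ℝ) : ℂ)) *
    shiftX d a.1 (modZ d a.2 f) q

theorem dispFun_apply {n : ℕ} (d : ℕ) (a : Phase n) (f : (Fin n → ℝ) → ℂ) (q : Fin n → ℝ) :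
    dispFun d a f q = Complex.exp (Complex.I * ((Real.pi * (a.1 ⬝ᵥ a.2) / d : ℝ) : ℂ)) *
      (Complex.exp (Complex.I * ((ell d * (a.2 ⬝ᵥ (q - ell d • a.1)) : ℝ) : ℂ)) *
        f (q - ell d • a.1)) := rfl

theorem norm_dispFun {n : ℕ} (d : ℕ) (a : Phase n) (f : (Fin n → ℝ) → ℂ) (q : Fin n → ℝ) :
    ‖dispFun d a f q‖ = ‖f (q - ell d • a.1)‖ := by
  rw [dispFun_apply, norm_mul, norm_mul, Complex.norm_exp_I_mul_ofReal,
    Complex.norm_exp_I_mul_ofReal, one_mul, one_mul]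

theorem measurePreserving_shift {n : ℕ} (c : Fin n → ℝ) :
    MeasurePreserving (fun q : Fin n → ℝ => q - c) volume volume :=
  measurePreserving_sub_right volume c

theorem dispFun_congr {n : ℕ} (d : ℕ) (a : Phase n) {f g : (Fin n → ℝ) → ℂ}
    (h : f =ᵐ[volume] g) : dispFun d a f =ᵐ[volume] dispFun d a g := by
  have := (measurePreserving_shift (ell d • a.1)).quasiMeasurePreserving.ae_eq_comp h
  filter_upwards [this] with q hq
  simp only [Function.comp_apply] at hq
  rw [dispFun_apply, dispFun_apply, hq]

theorem eLpNorm_dispFun {n : ℕ} (d : ℕ) (a : Phase n) {f : (Fin n → ℝ) → ℂ}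
    (hf : AEStronglyMeasurable f volume) :
    eLpNorm (dispFun d a f) 2 volume = eLpNorm f 2 volume := by
  rw [← eLpNorm_comp_measurePreserving hf (measurePreserving_shift (ell d • a.1))]
  exact eLpNorm_congr_norm_ae (Filter.Eventually.of_forall fun q => norm_dispFun d a f q)

theorem memLp_dispFun {n : ℕ} (d : ℕ) (a : Phase n) {f : (Fin n → ℝ) → ℂ}
    (hf : MemLp f 2 volume) : MemLp (dispFun d a f) 2 volume := by
  refine ⟨?_, (eLpNorm_dispFun d a hf.1).trans_lt hf.2⟩
  have h1 : AEStronglyMeasurable (fun q : Fin n → ℝ => f (q - ell d • a.1)) volume :=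
    hf.1.comp_measurePreserving (measurePreserving_shift (ell d • a.1))
  have h2 : Continuous fun q : Fin n → ℝ =>
      Complex.exp (Complex.I * ((ell d * (a.2 ⬝ᵥ (q - ell d • a.1)) : ℝ) : ℂ)) := by
    unfold dotProduct
    fun_prop
  exact (h2.aestronglyMeasurable.mul h1).const_mul _

/-- The displacement operator `T_a` on `L²(ℝⁿ)`. -/
def disp {n : ℕ} (d : ℕ) (a : Phase n) : Modes n →L[ℂ] Modes n :=
  LinearIsometry.toContinuousLinearMap
    { toFun := fun ψ => (memLp_dispFun d a (Lp.memLp ψ)).toLp (dispFun d a ψ)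
      map_add' := fun ψ χ => by
        rw [← MemLp.toLp_add]
        refine (MemLp.toLp_eq_toLp_iff _ _).2 ?_
        refine (dispFun_congr d a (Lp.coeFn_add ψ χ)).trans ?_
        refine Filter.Eventually.of_forall fun q => ?_
        simp only [dispFun_apply, Pi.add_apply]
        ring
      map_smul' := fun c ψ => by
        rw [RingHom.id_apply, ← MemLp.toLp_const_smul]
        refine (MemLp.toLp_eq_toLp_iff _ _).2 ?_
        refine (dispFun_congr d a (Lp.coeFn_smul c ψ)).trans ?_
        refine Filter.Eventually.of_forall fun q => ?_
        simp only [dispFun_apply, Pi.smul_apply, smul_eq_mul]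
        ring
      norm_map' := fun ψ => by
        change ‖(memLp_dispFun d a (Lp.memLp ψ)).toLp (dispFun d a ψ)‖ = ‖ψ‖
        rw [Lp.norm_toLp, eLpNorm_dispFun d a (Lp.memLp ψ).1, ← Lp.norm_def] }

theorem coeFn_disp {n : ℕ} (d : ℕ) (a : Phase n) (ψ : Modes n) :
    disp d a ψ =ᵐ[volume] dispFun d a ψ :=
  MemLp.coeFn_toLp (memLp_dispFun d a (Lp.memLp ψ))

/-! ### Trace-class operators and the trace -/

/-- Trace-class (nuclear) operators: sums of rank-one operators `|α_i⟩⟨β_i|` with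
`∑ ‖α_i‖ ‖β_i‖ < ∞`. -/
def IsTraceClass {n : ℕ} (C : Modes n →L[ℂ] Modes n) : Prop :=
  ∃ α β : ℕ → Modes n, Summable (fun i => ‖α i‖ * ‖β i‖) ∧
    HasSum (fun i => InnerProductSpace.rankOne ℂ (α i) (β i)) C

/-- The vectors of an orthonormal (Hilbert) basis of `L²(ℝⁿ)`. -/
def basisSet (n : ℕ) : Set (Modes n) := Classical.choose (exists_hilbertBasis ℂ (Modes n))

/-- The trace `Tr C = ∑_e ⟨e, C e⟩` over an orthonormal basis (for trace-class `C` the sum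
converges absolutely and does not depend on the basis). -/
def trace {n : ℕ} (C : Modes n →L[ℂ] Modes n) : ℂ :=
  ∑' e : basisSet n, ⟪(e : Modes n), C e⟫_ℂ

/-! ### The Zak-Gross Wigner function -/

/-- The operators for which the Zak-Gross Wigner function is defined: trace-class operators for
which the series over `ℤ^{2n}` converges absolutely. As the phase factors have modulus one, this
does not depend on the phase-space point. -/
def HasWigner {n : ℕ} (d : ℕ) (C : Modes n →L[ℂ] Modes n) : Prop :=
  IsTraceClass C ∧ Summable fun a : Lattice n => ‖trace (C * disp d a.toPhase)‖

/-- The Zak-Gross Wigner function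
`W_C(η) = (2π)⁻ⁿ ∑_{a ∈ ℤ^{2n}} exp (i ℓ [a, η] + i π a_X ⬝ a_Z) Tr (C T_a)`. -/
def wigner {n : ℕ} (d : ℕ) (C : Modes n →L[ℂ] Modes n) (η : Phase n) : ℂ :=
  1 / (2 * (Real.pi : ℂ)) ^ n * ∑' a : Lattice n,
    Complex.exp (Complex.I * ((ell d * symp a.toPhase η : ℝ) : ℂ) +
      Complex.I * ((Real.pi * (a.toPhase.1 ⬝ᵥ a.toPhase.2) : ℝ) : ℂ)) *
    trace (C * disp d a.toPhase)

/-- The box `[0, r)^{2n}`. -/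
def box (n : ℕ) (r : ℝ) : Set (Phase n) :=
  (Set.univ.pi fun _ => Set.Ico 0 r) ×ˢ (Set.univ.pi fun _ => Set.Ico 0 r)

/-- The measure `dη` on the torus `[0, dℓ)^{2n}`: Lebesgue measure divided by `dⁿ`, that is, the
invariant measure of total mass `(2π)ⁿ`, so that
`(2π)⁻ⁿ ∫ exp (i ℓ [a, η]) dη = δ_{a,0}` for integer `a`. -/
def torusMeasure (n d : ℕ) : Measure (Phase n) :=
  ENNReal.ofReal ((d : ℝ) ^ n)⁻¹ • volume.restrict (box n (d * ell d))

/-! ### GKP projectors and the twirl -/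

/-- The pairing `⟨j_GKP | f⟩ = ℓ^{-n/2} ∑_{m ∈ ℤⁿ} f (ℓ (d m + j))` of the `n`-mode GKP basis
state `|j_GKP⟩ = ⨂ₖ ℓ^{-1/2} ∑_{mₖ} |(d mₖ + jₖ) ℓ⟩` with a wave function `f`. -/
def gkpBra {n : ℕ} (d : ℕ) (j : Fin n → Fin d) (f : (Fin n → ℝ) → ℂ) : ℂ :=
  (((Real.sqrt (ell d))⁻¹ ^ n : ℝ) : ℂ) *
    ∑' m : Fin n → ℤ, f fun k => ell d * ((d : ℝ) * (m k : ℝ) + ((j k : ℕ) : ℝ))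

/-- The form `⟨f | P_s | g⟩` of the displaced GKP projector
`P_s = T_s (∑_j |j_GKP⟩⟨j_GKP|) T_{-s}`, where `T_s† = T_{-s}`. -/
def gkpForm {n : ℕ} (d : ℕ) (s : Phase n) (f g : (Fin n → ℝ) → ℂ) : ℂ :=
  ∑ j : Fin n → Fin d,
    starRingEnd ℂ (gkpBra d j (dispFun d (-s) f)) * gkpBra d j (dispFun d (-s) g)

/-- The measure `ds` on the unit cell `[0, 1)^{2n}` of syndromes: Lebesgue measure times
`ℓ^{2n}`, which is the normalization for which `∫ P_s ds = 1`. -/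
def cellMeasure (n d : ℕ) : Measure (Phase n) :=
  ENNReal.ofReal (ell d ^ (2 * n)) • volume.restrict (box n 1)

/-- `E = ∫ P_s C P_s ds` in the weak sense. As `P_s` maps Schwartz functions to tempered
distributions, the trace-class operator `C` is written as a trace-norm convergent sum of
rank-one operators `|α_i⟩⟨β_i|` with Schwartz functions `α_i`, `β_i` (such expansions exist, since
Schwartz functions are dense in `L²`), and the bounded operator `E` has the matrix elements
`⟨φ, E ψ⟩ = ∑_i ∫ ⟨φ|P_s|α_i⟩ ⟨β_i|P_s|ψ⟩ ds` for all Schwartz functions `φ`, `ψ`, whatever the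
expansion. -/
def IsTwirl {n : ℕ} (d : ℕ) (C E : Modes n →L[ℂ] Modes n) : Prop :=
  ∀ α β : ℕ → 𝓢(Fin n → ℝ, ℂ),
    Summable (fun i => ‖(α i).toLp 2 volume‖ * ‖(β i).toLp 2 volume‖) →
    HasSum (fun i => InnerProductSpace.rankOne ℂ ((α i).toLp 2 volume) ((β i).toLp 2 volume)) C →
    ∀ φ ψ : 𝓢(Fin n → ℝ, ℂ),
      (∀ i, Integrable (fun s => gkpForm d s φ (α i) * gkpForm d s (β i) ψ) (cellMeasure n d)) ∧
      HasSum (fun i => ∫ s, gkpForm d s φ (α i) * gkpForm d s (β i) ψ ∂cellMeasure n d)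
        ⟪φ.toLp 2 volume, E (ψ.toLp 2 volume)⟫_ℂ

open Classical in
/-- The twirling map `C ↦ ℰ(C) = ∫ P_s C P_s ds` (and `0` if there is no such bounded
operator). -/
def twirl {n : ℕ} (d : ℕ) (C : Modes n →L[ℂ] Modes n) : Modes n →L[ℂ] Modes n :=
  if h : ∃ E, IsTwirl d C E then Classical.choose h else 0

/-! ### The trace on operators that commute with the stabilizers -/

/-- The cube `ℓ (j + [0, 1)ⁿ)` in position space. -/
def posCell {n : ℕ} (d : ℕ) (j : Fin n → Fin d) : Set (Fin n → ℝ) :=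
  Set.univ.pi fun k => Set.Ico (ell d * ((j k : ℕ) : ℝ)) (ell d * (((j k : ℕ) : ℝ) + 1))

theorem measurableSet_posCell {n : ℕ} (d : ℕ) (j : Fin n → Fin d) :
    MeasurableSet (posCell d j) :=
  MeasurableSet.univ_pi fun _ => measurableSet_Ico

theorem volume_posCell_ne_top {n : ℕ} (d : ℕ) (j : Fin n → Fin d) :
    volume (posCell d j) ≠ ⊤ := by
  rw [posCell, Real.volume_pi_Ico]
  exact ENNReal.prod_ne_top fun _ _ => ENNReal.ofReal_ne_top

/-- The normalized indicator function `ℓ^{-n/2} 1` of the cube `ℓ (j + [0, 1)ⁿ)`. The vectors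
`T_{d a} (cellVec d j)`, for `a ∈ ℤ^{2n}` and `j ∈ {0, …, d-1}ⁿ`, are an orthonormal basis of
`L²(ℝⁿ)`. -/
def cellVec {n : ℕ} (d : ℕ) (j : Fin n → Fin d) : Modes n :=
  indicatorConstLp 2 (measurableSet_posCell d j) (volume_posCell_ne_top d j)
    (((Real.sqrt (ell d))⁻¹ ^ n : ℝ) : ℂ)

/-- The trace per stabilizer, for operators `X` that commute with all the stabilizers `T_{d a}`,
`a ∈ ℤ^{2n}`. The ordinary trace of such an `X`, computed in the basis `T_{d a} (cellVec d j)`, is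
the sum over `a ∈ ℤ^{2n}` of copies of one and the same number `∑_j ⟨cellVec d j, X cellVec d j⟩`;
this number is kept once, times `(2π/d)ⁿ`, the normalization with `cellTrace d (twirl d C) = Tr C`
(as `ℰ(C) = (d/2π)ⁿ ∑_a T_{d a} C T_{d a}†`). -/
def cellTrace {n : ℕ} (d : ℕ) (X : Modes n →L[ℂ] Modes n) : ℂ :=
  ((2 * Real.pi / d : ℝ) : ℂ) ^ n * ∑ j : Fin n → Fin d, ⟪cellVec d j, X (cellVec d j)⟫_ℂ

end ZakGross

end

/-!
By the Weyl relations the displacements `T_a` with integer `a` multiply up to phases, and the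
Wigner function is an absolutely convergent Fourier series with coefficients `± Tr (C T_a)`:
linearity, reality, standardization and covariance are read off the coefficients.

The heart of traciality is the expansion `ℰ(C) = (2π)⁻ⁿ ∑_a Tr (C T_{-a}) T_a` of the twirl. In the
unit of length `d ℓ`, the form `⟨f|P_s|g⟩` is the sum of `conj (Z f) * Z g` over the `dⁿ` points
`((j + s_X) / d, s_Z)`, where `Z` is the Zak transform. For a product of two such forms, the pairs
of points are grouped by their difference `r / d`. The Fourier coefficients of `conj (Z f) * Z g`,
with `g` translated by `r / d`, are the matrix elements of the displacements of index
`(r - d a_Z, a_X)`, so Parseval's identity, summed over `r`, gives a sum over the whole lattice.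

Trace-norm convergence then gives `Tr (ℰ(C) D) = (2π)⁻ⁿ ∑_a Tr (C T_{-a}) Tr (D T_a)`, integrating
the product of the two Fourier series gives the same value for `∫ W_C W_D`, and
`τ (T_a) = (2π)ⁿ δ_{a,0}` gives it for `τ (ℰ(C) ℰ(D))`.
-/

noncomputable section

namespace ZakGross

/-! ### Nuclear expansions -/

section NuclearSum

open InnerProductSpace

variable {𝕜 E F G ι κ μ : Type*} [RCLike 𝕜]
  [NormedAddCommGroup E] [InnerProductSpace 𝕜 E]
  [NormedAddCommGroup F] [InnerProductSpace 𝕜 F]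
  [NormedAddCommGroup G] [InnerProductSpace 𝕜 G]

/-- A nuclear expansion of `C`: the rank-one operators `|α_i⟩⟨β_i|` sum to `C` with
`∑ ‖α_i‖ ‖β_i‖ < ∞`. The index type is arbitrary, so that sums and refinements of expansions need
no reindexing. -/
def IsNuclearSum (α : ι → E) (β : ι → F) (C : F →L[𝕜] E) : Prop :=
  Summable (fun i => ‖α i‖ * ‖β i‖) ∧ HasSum (fun i => rankOne 𝕜 (α i) (β i)) C

namespace IsNuclearSum

variable {α : ι → E} {β : ι → F} {C : F →L[𝕜] E}

theorem comp_equiv (h : IsNuclearSum α β C) (e : κ ≃ ι) : IsNuclearSum (α ∘ e) (β ∘ e) C :=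
  ⟨(e.summable_iff (f := fun i => ‖α i‖ * ‖β i‖)).2 h.1,
    (e.hasSum_iff (f := fun i => rankOne 𝕜 (α i) (β i))).2 h.2⟩

theorem comp_left (h : IsNuclearSum α β C) (A : E →L[𝕜] G) :
    IsNuclearSum (fun i => A (α i)) β (A ∘L C) := by
  refine ⟨.of_nonneg_of_le (fun i => by positivity) (fun i => ?_) (h.1.mul_left ‖A‖), ?_⟩
  · rw [← mul_assoc]
    gcongr
    exact A.le_opNorm _
  · simpa only [ContinuousLinearMap.compL_apply, comp_rankOne] using
      h.2.mapL (ContinuousLinearMap.compL 𝕜 F E G A)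

theorem adjoint [CompleteSpace E] [CompleteSpace F] (h : IsNuclearSum α β C) :
    IsNuclearSum β α (ContinuousLinearMap.adjoint C) := by
  refine ⟨by simpa only [mul_comm] using h.1, ?_⟩
  simpa only [Function.comp_def, adjoint_rankOne] using
    h.2.map (ContinuousLinearMap.adjoint (𝕜 := 𝕜) (E := F) (F := E))
      (ContinuousLinearMap.adjoint (𝕜 := 𝕜) (E := F) (F := E)).continuous

theorem comp_right [CompleteSpace E] [CompleteSpace F] [CompleteSpace G]
    (h : IsNuclearSum α β C) (A : G →L[𝕜] F) :
    IsNuclearSum α (fun i => ContinuousLinearMap.adjoint A (β i)) (C ∘L A) := by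
  simpa only [ContinuousLinearMap.adjoint_comp, ContinuousLinearMap.adjoint_adjoint] using
    (h.adjoint.comp_left (ContinuousLinearMap.adjoint A)).adjoint

theorem smul (h : IsNuclearSum α β C) (c : 𝕜) : IsNuclearSum (fun i => c • α i) β (c • C) := by
  simpa using h.comp_left (c • ContinuousLinearMap.id 𝕜 E)

theorem add {α' : κ → E} {β' : κ → F} {D : F →L[𝕜] E} (h : IsNuclearSum α β C)
    (h' : IsNuclearSum α' β' D) : IsNuclearSum (Sum.elim α α') (Sum.elim β β') (C + D) :=
  ⟨(HasSum.sum (f := fun i => ‖Sum.elim α α' i‖ * ‖Sum.elim β β' i‖)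
      h.1.hasSum h'.1.hasSum).summable,
    HasSum.sum (f := fun i => rankOne 𝕜 (Sum.elim α α' i) (Sum.elim β β' i)) h.2 h'.2⟩

end IsNuclearSum

theorem hasSum_rankOne_prod {x : E} {y : F} {a : κ → E} {b : μ → F} (ha : HasSum a x)
    (hb : HasSum b y) (h : Summable fun p : κ × μ => rankOne 𝕜 (a p.1) (b p.2)) :
    HasSum (fun p : κ × μ => rankOne 𝕜 (a p.1) (b p.2)) (rankOne 𝕜 x y) := by
  have hfib : ∀ k, HasSum (fun l => rankOne 𝕜 (a k) (b l)) (rankOne 𝕜 (a k) y) := fun k =>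
    hb.map (rankOne (F := F) 𝕜 (a k)) (rankOne (F := F) 𝕜 (a k)).continuous
  have hsum : HasSum (fun k => rankOne 𝕜 (a k) y) (rankOne 𝕜 x y) :=
    ha.map ((rankOne (E := E) (F := F) 𝕜).flip y) ((rankOne (E := E) (F := F) 𝕜).flip y).continuous
  rw [hsum.unique (h.hasSum.prod_fiberwise hfib)]
  exact h.hasSum

theorem IsNuclearSum.refine [CompleteSpace E] {x : ι → E} {y : ι → F} {C : F →L[𝕜] E}
    (h : IsNuclearSum x y C) {a : ι → κ → E} {b : ι → μ → F} {u : κ → ℝ} {v : μ → ℝ}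
    (hu : Summable u) (hv : Summable v) (hu0 : 0 ≤ u) (hv0 : 0 ≤ v)
    (hau : ∀ i k, ‖a i k‖ ≤ ‖x i‖ * u k) (hbv : ∀ i k, ‖b i k‖ ≤ ‖y i‖ * v k)
    (ha : ∀ i, HasSum (a i) (x i)) (hb : ∀ i, HasSum (b i) (y i)) :
    IsNuclearSum (fun p : ι × κ × μ => a p.1 p.2.1) (fun p => b p.1 p.2.2) C := by
  have hdom : Summable fun p : ι × κ × μ => ‖x p.1‖ * ‖y p.1‖ * (u p.2.1 * v p.2.2) :=
    h.1.mul_of_nonneg (hu.mul_of_nonneg hv hu0 hv0) (fun _ => by positivity)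
      fun p => mul_nonneg (hu0 p.1) (hv0 p.2)
  have hnorm : Summable fun p : ι × κ × μ => ‖a p.1 p.2.1‖ * ‖b p.1 p.2.2‖ := by
    refine .of_nonneg_of_le (fun p => by positivity) (fun p => ?_) hdom
    refine (mul_le_mul (hau _ _) (hbv _ _) (norm_nonneg _)
      (mul_nonneg (norm_nonneg _) (hu0 _))).trans_eq ?_
    ring
  have hop : Summable fun p : ι × κ × μ => rankOne 𝕜 (a p.1 p.2.1) (b p.1 p.2.2) :=
    .of_norm (by simpa only [norm_rankOne] using hnorm)
  have hfib : ∀ i, HasSum (fun p : κ × μ => rankOne 𝕜 (a i p.1) (b i p.2))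
      (rankOne 𝕜 (x i) (y i)) := fun i => hasSum_rankOne_prod (ha i) (hb i) (hop.prod_factor i)
  exact ⟨hnorm, (hop.hasSum.prod_fiberwise hfib).unique h.2 ▸ hop.hasSum⟩

theorem exists_hasSum_of_denseRange [CompleteSpace E] {V : Type*} [AddCommGroup V] (L : V →+ E)
    (hL : DenseRange L) (x : E) :
    ∃ a : ℕ → V, (∀ k, ‖L (a k)‖ ≤ ‖x‖ * (2 * (1 / 2) ^ k)) ∧ HasSum (fun k => L (a k)) x := by
  rcases eq_or_ne x 0 with rfl | hx
  · exact ⟨0, by simp, by simp⟩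
  have hx0 := norm_pos_iff.2 hx
  have hmem : x ∈ closure (L.range : Set E) := by simpa only [AddMonoidHom.coe_range] using hL x
  obtain ⟨v, hlim, hv, hzero, hpos⟩ := controlled_sum_of_mem_closure hmem
    (b := fun k => ‖x‖ * (1 / 2) ^ k) (fun k => by positivity)
  choose a ha using hv
  have hbound : ∀ k, ‖v k‖ ≤ ‖x‖ * (2 * (1 / 2) ^ k) := by
    rintro (_ | k)
    · have := norm_le_norm_add_norm_sub' (v 0) x
      rw [norm_sub_rev, sub_eq_neg_add] at this
      rw [pow_zero, mul_one] at hzero ⊢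
      linarith
    · refine (hpos _ k.succ_pos).le.trans (mul_le_mul_of_nonneg_left ?_ hx0.le)
      exact le_mul_of_one_le_left (pow_pos one_half_pos _).le one_le_two
  have hs : Summable v :=
    .of_norm_bounded ((summable_geometric_two.mul_left _).mul_left _) hbound
  refine ⟨a, fun k => (ha k).symm ▸ hbound k, ?_⟩
  simp only [ha]
  rw [← tendsto_nhds_unique (hs.hasSum.tendsto_sum_nat.comp (Filter.tendsto_add_atTop_nat 1)) hlim]
  exact hs.hasSum

section HilbertBasis

variable (b : HilbertBasis κ 𝕜 E)

theorem hasSum_norm_inner_hilbertBasis_sq (x : E) :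
    HasSum (fun e => ‖⟪x, b e⟫_𝕜‖ ^ 2) (‖x‖ ^ 2) := by
  have h := RCLike.hasSum_re 𝕜 (b.hasSum_inner_mul_inner x x)
  simpa only [inner_mul_symm_re_eq_norm, norm_mul, norm_inner_symm (b _) x, ← sq,
    inner_self_eq_norm_sq] using h

theorem exists_hasSum_norm_inner_mul_inner_le (x y : E) :
    ∃ c ≤ ‖x‖ * ‖y‖, HasSum (fun e => ‖⟪x, b e⟫_𝕜‖ * ‖⟪b e, y⟫_𝕜‖) c := by
  obtain ⟨c, -, hc, hs⟩ := Real.inner_le_Lp_mul_Lq_hasSum_of_nonneg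
    (f := fun e => ‖⟪x, b e⟫_𝕜‖) (g := fun e => ‖⟪b e, y⟫_𝕜‖)
    Real.HolderConjugate.two_two (norm_nonneg x) (norm_nonneg y)
    (fun _ => norm_nonneg _) (fun _ => norm_nonneg _)
    (by simpa only [Real.rpow_two] using hasSum_norm_inner_hilbertBasis_sq b x)
    (by simpa only [Real.rpow_two, norm_inner_symm] using hasSum_norm_inner_hilbertBasis_sq b y)
  exact ⟨c, hc, hs⟩

theorem summable_inner_mul_inner_hilbertBasis {α β : ι → E}
    (h : Summable fun i => ‖α i‖ * ‖β i‖) :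
    Summable fun p : ι × κ => ⟪β p.1, b p.2⟫_𝕜 * ⟪b p.2, α p.1⟫_𝕜 := by
  choose c hc hs using fun i => exists_hasSum_norm_inner_mul_inner_le b (β i) (α i)
  refine .of_norm ?_
  simp only [norm_mul]
  refine (summable_prod_of_nonneg fun p => by positivity).2 ⟨fun i => (hs i).summable, ?_⟩
  refine .of_nonneg_of_le (fun i => tsum_nonneg fun e => by positivity) (fun i => ?_) h
  rw [(hs i).tsum_eq, mul_comm]
  exact hc i

/-- Swapping the sums over the expansion and over the basis shows that the trace does not depend
on the latter. -/
theorem IsNuclearSum.hasSum_inner_tsum {α β : ι → E} {C : E →L[𝕜] E} (h : IsNuclearSum α β C) :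
    HasSum (fun i => ⟪β i, α i⟫_𝕜) (∑' e, ⟪b e, C (b e)⟫_𝕜) := by
  have hs := summable_inner_mul_inner_hilbertBasis b h.1
  have hbasis : ∀ e, HasSum (fun i => ⟪β i, b e⟫_𝕜 * ⟪b e, α i⟫_𝕜) ⟪b e, C (b e)⟫_𝕜 := fun e => by
    simpa [inner_smul_right] using
      (h.2.mapL (ContinuousLinearMap.apply 𝕜 E (b e))).mapL (innerSL 𝕜 (b e))
  rw [(((Equiv.prodComm ι κ).symm.hasSum_iff.2 hs.hasSum).prod_fiberwise hbasis).tsum_eq]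
  exact hs.hasSum.prod_fiberwise fun i => b.hasSum_inner_mul_inner (β i) (α i)

end HilbertBasis

end NuclearSum

/-! ### Trace-class operators on the mode space -/

section TraceClass

variable {n : ℕ} {ι : Type*} {α β : ι → Modes n} {C D : Modes n →L[ℂ] Modes n}

theorem IsNuclearSum.isTraceClass [Denumerable ι] (h : IsNuclearSum α β C) : IsTraceClass C :=
  ⟨_, _, h.comp_equiv (Denumerable.eqv ι).symm⟩

theorem IsNuclearSum.hasSum_trace (h : IsNuclearSum α β C) :
    HasSum (fun i => ⟪β i, α i⟫_ℂ) (trace C) := by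
  obtain ⟨b, hb⟩ := Classical.choose_spec (exists_hilbertBasis ℂ (Modes n))
  have := h.hasSum_inner_tsum b
  rwa [hb] at this

theorem IsNuclearSum.norm_trace_mul_le (h : IsNuclearSum α β C) (A : Modes n →L[ℂ] Modes n) :
    ‖trace (A * C)‖ ≤ ‖A‖ * ∑' i, ‖α i‖ * ‖β i‖ := by
  rw [ContinuousLinearMap.mul_def, ← (h.comp_left A).hasSum_trace.tsum_eq, ← tsum_mul_left]
  refine tsum_of_norm_bounded (h.1.mul_left _).hasSum fun i => ?_
  calc ‖⟪β i, A (α i)⟫_ℂ‖ ≤ ‖β i‖ * ‖A (α i)‖ := norm_inner_le_norm _ _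
    _ ≤ ‖β i‖ * (‖A‖ * ‖α i‖) := by gcongr; exact A.le_opNorm _
    _ = ‖A‖ * (‖α i‖ * ‖β i‖) := by ring

theorem trace_smul (c : ℂ) (C : Modes n →L[ℂ] Modes n) : trace (c • C) = c * trace C := by
  simp only [trace, smul_apply, inner_smul_right, tsum_mul_left]

theorem denseRange_schwartz_toLp (n : ℕ) :
    DenseRange fun φ : 𝓢(Fin n → ℝ, ℂ) => φ.toLp 2 volume :=
  SchwartzMap.denseRange_toLpCLM (E := Fin n → ℝ) (F := ℂ) (p := 2) ENNReal.ofNat_ne_top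
    (μ := volume)

namespace IsTraceClass

theorem exists_isNuclearSum (h : IsTraceClass C) : ∃ α β : ℕ → Modes n, IsNuclearSum α β C := h

theorem mul_left (h : IsTraceClass C) (A : Modes n →L[ℂ] Modes n) : IsTraceClass (A * C) := by
  obtain ⟨α, β, h⟩ := h.exists_isNuclearSum
  exact (h.comp_left A).isTraceClass

theorem mul_right (h : IsTraceClass C) (A : Modes n →L[ℂ] Modes n) : IsTraceClass (C * A) := by
  obtain ⟨α, β, h⟩ := h.exists_isNuclearSum
  exact (h.comp_right A).isTraceClass

theorem adjoint (h : IsTraceClass C) : IsTraceClass (ContinuousLinearMap.adjoint C) := by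
  obtain ⟨α, β, h⟩ := h.exists_isNuclearSum
  exact h.adjoint.isTraceClass

theorem smul (h : IsTraceClass C) (c : ℂ) : IsTraceClass (c • C) := by
  obtain ⟨α, β, h⟩ := h.exists_isNuclearSum
  exact (h.smul c).isTraceClass

theorem add (h : IsTraceClass C) (h' : IsTraceClass D) : IsTraceClass (C + D) := by
  obtain ⟨α, β, h⟩ := h.exists_isNuclearSum
  obtain ⟨α', β', h'⟩ := h'.exists_isNuclearSum
  exact (h.add h').isTraceClass

theorem trace_mul_comm (h : IsTraceClass C) (A : Modes n →L[ℂ] Modes n) :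
    trace (A * C) = trace (C * A) := by
  obtain ⟨α, β, h⟩ := h.exists_isNuclearSum
  refine (h.comp_left A).hasSum_trace.unique ?_
  simpa only [ContinuousLinearMap.mul_def, ContinuousLinearMap.adjoint_inner_left] using
    (h.comp_right A).hasSum_trace

theorem trace_add (h : IsTraceClass C) (h' : IsTraceClass D) :
    trace (C + D) = trace C + trace D := by
  obtain ⟨α, β, h⟩ := h.exists_isNuclearSum
  obtain ⟨α', β', h'⟩ := h'.exists_isNuclearSum
  exact (h.add h').hasSum_trace.unique
    (HasSum.sum (f := fun i => ⟪Sum.elim β β' i, Sum.elim α α' i⟫_ℂ)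
      h.hasSum_trace h'.hasSum_trace)

theorem trace_adjoint (h : IsTraceClass C) :
    trace (ContinuousLinearMap.adjoint C) = starRingEnd ℂ (trace C) := by
  obtain ⟨α, β, h⟩ := h.exists_isNuclearSum
  refine h.adjoint.hasSum_trace.unique ?_
  simpa only [Function.comp_def, inner_conj_symm] using
    h.hasSum_trace.map (starRingEnd ℂ) Complex.continuous_conj

theorem hasSum_trace_mul {κ : Type*} (h : IsTraceClass C) {A : κ → Modes n →L[ℂ] Modes n}
    {B : Modes n →L[ℂ] Modes n} (hA : HasSum A B) :
    HasSum (fun k => trace (A k * C)) (trace (B * C)) := by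
  obtain ⟨α, β, hC⟩ := h.exists_isNuclearSum
  let traceMul : (Modes n →L[ℂ] Modes n) →ₗ[ℂ] ℂ :=
    { toFun := fun A => trace (A * C)
      map_add' := fun A A' => by rw [add_mul, (h.mul_left A).trace_add (h.mul_left A')]
      map_smul' := fun c A => by
        rw [smul_mul_assoc, trace_smul, RingHom.id_apply, smul_eq_mul] }
  exact hA.mapL (traceMul.mkContinuous (∑' i, ‖α i‖ * ‖β i‖) fun A =>
    (hC.norm_trace_mul_le A).trans_eq (mul_comm _ _))

theorem exists_schwartz (h : IsTraceClass C) :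
    ∃ α β : ℕ → 𝓢(Fin n → ℝ, ℂ),
      IsNuclearSum (fun i => (α i).toLp 2 volume) (fun i => (β i).toLp 2 volume) C := by
  obtain ⟨x, y, hC⟩ := h.exists_isNuclearSum
  have hexp : ∀ z : Modes n, ∃ f : ℕ → 𝓢(Fin n → ℝ, ℂ),
      (∀ k, ‖(f k).toLp 2 volume‖ ≤ ‖z‖ * (2 * (1 / 2) ^ k)) ∧
        HasSum (fun k => (f k).toLp 2 volume) z :=
    exists_hasSum_of_denseRange
      (SchwartzMap.toLpCLM (E := Fin n → ℝ) ℂ ℂ 2 volume).toLinearMap.toAddMonoidHom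
      (denseRange_schwartz_toLp n)
  choose a ha hax using fun i => hexp (x i)
  choose b hb hby using fun i => hexp (y i)
  have hgeom : Summable fun k : ℕ => 2 * (1 / 2 : ℝ) ^ k := summable_geometric_two.mul_left 2
  let e := (Denumerable.eqv (ℕ × ℕ × ℕ)).symm
  exact ⟨fun i => a (e i).1 (e i).2.1, fun i => b (e i).1 (e i).2.2,
    (hC.refine hgeom hgeom (fun k => by positivity) (fun k => by positivity)
      ha hb hax hby).comp_equiv e⟩

end IsTraceClass

end TraceClass

/-! ### The Weyl relations -/

/-- The phase `exp (i x)`. -/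
def phase (x : ℝ) : ℂ := Complex.exp (Complex.I * (x : ℂ))

theorem phase_zero : phase 0 = 1 := by simp [phase]

theorem phase_add (x y : ℝ) : phase (x + y) = phase x * phase y := by
  rw [phase, phase, phase, ← Complex.exp_add]
  push_cast
  ring_nf

theorem phase_sum {ι : Type*} (s : Finset ι) (f : ι → ℝ) :
    phase (∑ i ∈ s, f i) = ∏ i ∈ s, phase (f i) := by
  simp only [phase]
  push_cast
  rw [Finset.mul_sum, Complex.exp_sum]

theorem norm_phase (x : ℝ) : ‖phase x‖ = 1 := Complex.norm_exp_I_mul_ofReal x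

theorem conj_phase (x : ℝ) : starRingEnd ℂ (phase x) = phase (-x) := by
  rw [phase, phase, ← Complex.exp_conj]
  simp

theorem phase_two_pi_mul_int (k : ℤ) : phase (2 * Real.pi * k) = 1 := by
  rw [phase, Complex.exp_eq_one_iff]
  exact ⟨k, by push_cast; ring⟩

@[fun_prop]
theorem continuous_phase : Continuous phase := by
  unfold phase
  fun_prop

section Weyl

variable {n : ℕ}

theorem symp_self (a : Phase n) : symp a a = 0 := by
  rw [symp, dotProduct_comm, sub_self]

theorem symp_swap (a b : Phase n) : symp b a = -symp a b := by
  rw [symp, symp, dotProduct_comm b.1, dotProduct_comm b.2, neg_sub]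

theorem symp_add_right (a b c : Phase n) : symp a (b + c) = symp a b + symp a c := by
  simp only [symp, Prod.fst_add, Prod.snd_add, dotProduct_add]
  ring

theorem symp_add_left (a b c : Phase n) : symp (a + b) c = symp a c + symp b c := by
  rw [symp_swap, symp_add_right, neg_add, ← symp_swap, ← symp_swap]

theorem symp_smul_right (r : ℝ) (a b : Phase n) : symp a (r • b) = r * symp a b := by
  simp only [symp, Prod.smul_fst, Prod.smul_snd, dotProduct_smul, smul_eq_mul]
  ring

theorem symp_neg_right (a b : Phase n) : symp a (-b) = -symp a b := by
  rw [← neg_one_smul ℝ b, symp_smul_right, neg_one_mul]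

theorem symp_neg_left (a b : Phase n) : symp (-a) b = -symp a b := by
  rw [symp_swap, symp_neg_right, ← symp_swap]

variable {d : ℕ}

theorem ell_pos (hd : 0 < d) : 0 < ell d :=
  Real.sqrt_pos.2 (div_pos Real.two_pi_pos (Nat.cast_pos.2 hd))

theorem ell_mul_ell (d : ℕ) : ell d * ell d = 2 * Real.pi / d :=
  Real.mul_self_sqrt (by positivity)

theorem dispFun_eq (d : ℕ) (a : Phase n) (f : (Fin n → ℝ) → ℂ) (q : Fin n → ℝ) :
    dispFun d a f q = phase (ell d * (a.2 ⬝ᵥ q) - Real.pi * (a.1 ⬝ᵥ a.2) / d) *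
      f (q - ell d • a.1) := by
  rw [dispFun_apply, ← mul_assoc]
  change phase _ * phase _ * _ = _
  rw [← phase_add, dotProduct_sub, dotProduct_smul, mul_sub, smul_eq_mul, ← mul_assoc (ell d),
    ell_mul_ell, dotProduct_comm a.2 a.1]
  ring_nf

theorem dispFun_dispFun (d : ℕ) (a b : Phase n) (f : (Fin n → ℝ) → ℂ) :
    dispFun d a (dispFun d b f) = phase (-(Real.pi * symp a b / d)) • dispFun d (a + b) f := by
  ext q
  have hshift : q - ell d • a.1 - ell d • b.1 = q - ell d • (a + b).1 := by
    rw [Prod.fst_add, smul_add, sub_sub]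
  rw [Pi.smul_apply, smul_eq_mul, dispFun_eq, dispFun_eq, dispFun_eq, ← mul_assoc, ← mul_assoc,
    ← phase_add, ← phase_add, hshift]
  congr 2
  simp only [symp, Prod.fst_add, Prod.snd_add, add_dotProduct, dotProduct_add, dotProduct_sub,
    dotProduct_smul, smul_eq_mul, mul_sub]
  rw [← mul_assoc, ell_mul_ell, dotProduct_comm b.2 a.1, dotProduct_comm a.2 b.1]
  ring

theorem disp_mul_disp (d : ℕ) (a b : Phase n) :
    disp d a * disp d b = phase (-(Real.pi * symp a b / d)) • disp d (a + b) := by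
  ext1 ψ
  apply Lp.ext
  rw [mul_apply_eq_comp, smul_apply]
  filter_upwards [coeFn_disp d a (disp d b ψ), dispFun_congr d a (coeFn_disp d b ψ),
    Lp.coeFn_smul (phase (-(Real.pi * symp a b / d))) (disp d (a + b) ψ),
    coeFn_disp d (a + b) ψ] with q hab hb hsmul hsum
  rw [hab, hb, hsmul, dispFun_dispFun, Pi.smul_apply, Pi.smul_apply, hsum]

theorem disp_zero : disp (n := n) d 0 = 1 := by
  ext1 ψ
  apply Lp.ext
  refine (coeFn_disp d 0 _).trans (Filter.Eventually.of_forall fun q => ?_)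
  simp [dispFun_apply]

theorem norm_disp_apply (a : Phase n) (ψ : Modes n) : ‖disp d a ψ‖ = ‖ψ‖ := by
  rw [disp, LinearIsometry.coe_toContinuousLinearMap, LinearIsometry.norm_map]

theorem norm_disp_le (a : Phase n) : ‖disp (n := n) d a‖ ≤ 1 :=
  ContinuousLinearMap.opNorm_le_bound _ zero_le_one fun ψ => by rw [norm_disp_apply, one_mul]

theorem inner_disp_disp (a : Phase n) (φ ψ : Modes n) :
    ⟪disp d a φ, disp d a ψ⟫_ℂ = ⟪φ, ψ⟫_ℂ :=
  LinearIsometry.inner_map_map ⟨(disp d a).toLinearMap, norm_disp_apply a⟩ φ ψ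

theorem disp_mul_disp_neg (a : Phase n) : disp d a * disp d (-a) = 1 := by
  rw [disp_mul_disp, symp_neg_right, symp_self, add_neg_cancel, disp_zero]
  simp [phase_zero]

theorem adjoint_disp (a : Phase n) : ContinuousLinearMap.adjoint (disp d a) = disp d (-a) := by
  refine ((ContinuousLinearMap.eq_adjoint_iff _ _).2 fun φ ψ => ?_).symm
  rw [← inner_disp_disp a, ← mul_apply_eq_comp, disp_mul_disp_neg, one_apply_eq_self]

theorem disp_neg_mul_disp_mul_disp (a b : Phase n) :
    disp d (-b) * disp d a * disp d b = phase (-(2 * Real.pi * symp a b / d)) • disp d a := by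
  rw [disp_mul_disp, smul_mul_assoc, disp_mul_disp, smul_smul, ← phase_add, symp_add_left,
    symp_neg_left, symp_neg_left, symp_self, symp_swap a b, neg_add_cancel_comm]
  ring_nf

end Weyl

/-! ### The Wigner function as a Fourier series -/

section Wigner

variable {n d : ℕ}

theorem Lattice.toPhase_neg (a : Lattice n) : (-a).toPhase = -a.toPhase := by
  ext <;> simp [Lattice.toPhase]

theorem Lattice.toPhase_add (a b : Lattice n) : (a + b).toPhase = a.toPhase + b.toPhase := by
  ext <;> simp [Lattice.toPhase]

theorem Lattice.toPhase_zero : (0 : Lattice n).toPhase = 0 := by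
  ext <;> simp [Lattice.toPhase]

/-- The characteristic function `a ↦ Tr (C T_a)` of an operator, on the integer lattice. Up to
signs, its values are the Fourier coefficients of the Wigner function. -/
def charFn (d : ℕ) (C : Modes n →L[ℂ] Modes n) (a : Lattice n) : ℂ :=
  trace (C * disp d a.toPhase)

/-- The sign `exp (i π a_X ⬝ a_Z) = ±1` of a lattice point. -/
def latticeSign (a : Lattice n) : ℂ := phase (Real.pi * (a.toPhase.1 ⬝ᵥ a.toPhase.2))

theorem latticeSign_eq (a : Lattice n) :
    latticeSign a = phase (Real.pi * ((a.1 ⬝ᵥ a.2 : ℤ) : ℝ)) := by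
  simp [latticeSign, Lattice.toPhase, dotProduct]

theorem latticeSign_mul_self (a : Lattice n) : latticeSign a * latticeSign a = 1 := by
  rw [latticeSign_eq, ← phase_add, ← phase_two_pi_mul_int (a.1 ⬝ᵥ a.2)]
  ring_nf

theorem latticeSign_neg (a : Lattice n) : latticeSign (-a) = latticeSign a := by
  simp [latticeSign, Lattice.toPhase_neg]

theorem norm_latticeSign (a : Lattice n) : ‖latticeSign a‖ = 1 := norm_phase _

theorem conj_latticeSign (a : Lattice n) : starRingEnd ℂ (latticeSign a) = latticeSign a := by
  rw [← mul_one (starRingEnd ℂ _), ← latticeSign_mul_self a, ← mul_assoc,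
    ← Complex.normSq_eq_conj_mul_self, Complex.normSq_eq_norm_sq, norm_latticeSign]
  simp

theorem wigner_eq (C : Modes n →L[ℂ] Modes n) (η : Phase n) :
    wigner d C η = 1 / (2 * (Real.pi : ℂ)) ^ n *
      ∑' a : Lattice n, phase (ell d * symp a.toPhase η) * (latticeSign a * charFn d C a) := by
  simp only [wigner, Complex.exp_add, mul_assoc]
  rfl

section CharFn

variable {C D : Modes n →L[ℂ] Modes n}

theorem charFn_zero (C : Modes n →L[ℂ] Modes n) : charFn d C 0 = trace C := by
  rw [charFn, Lattice.toPhase_zero, disp_zero, mul_one]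

theorem charFn_add (hC : IsTraceClass C) (hD : IsTraceClass D) (a : Lattice n) :
    charFn d (C + D) a = charFn d C a + charFn d D a := by
  rw [charFn, add_mul, (hC.mul_right _).trace_add (hD.mul_right _), charFn, charFn]

theorem charFn_smul (c : ℂ) (C : Modes n →L[ℂ] Modes n) (a : Lattice n) :
    charFn d (c • C) a = c * charFn d C a := by
  rw [charFn, smul_mul_assoc, trace_smul, charFn]

theorem charFn_adjoint (hC : IsTraceClass C) (a : Lattice n) :
    charFn d (ContinuousLinearMap.adjoint C) a = starRingEnd ℂ (charFn d C (-a)) := by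
  rw [charFn, charFn, ← (hC.mul_right _).trace_adjoint, Lattice.toPhase_neg,
    ContinuousLinearMap.mul_def C, ContinuousLinearMap.adjoint_comp, adjoint_disp, neg_neg,
    ← ContinuousLinearMap.mul_def, hC.adjoint.trace_mul_comm]

theorem charFn_disp_conj (hC : IsTraceClass C) (b : Phase n) (a : Lattice n) :
    charFn d (disp d b * C * ContinuousLinearMap.adjoint (disp d b)) a =
      phase (-(2 * Real.pi * symp a.toPhase b / d)) * charFn d C a := by
  rw [charFn, charFn, adjoint_disp, mul_assoc, mul_assoc, (hC.mul_right _).trace_mul_comm,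
    mul_assoc, disp_neg_mul_disp_mul_disp, mul_smul_comm, trace_smul]

end CharFn

namespace HasWigner

variable {C D : Modes n →L[ℂ] Modes n}

theorem isTraceClass (hC : HasWigner d C) : IsTraceClass C := hC.1

theorem summable_norm_charFn (hC : HasWigner d C) : Summable fun a => ‖charFn d C a‖ := hC.2

theorem summable_phase_mul (hC : HasWigner d C) (η : Phase n) :
    Summable fun a : Lattice n =>
      phase (ell d * symp a.toPhase η) * (latticeSign a * charFn d C a) := by
  refine .of_norm (hC.summable_norm_charFn.congr fun a => ?_)
  rw [norm_mul, norm_mul, norm_phase, norm_latticeSign, one_mul, one_mul]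

theorem add (hC : HasWigner d C) (hD : HasWigner d D) : HasWigner d (C + D) := by
  refine ⟨hC.1.add hD.1, .of_nonneg_of_le (fun _ => norm_nonneg _) (fun a => ?_)
    (hC.summable_norm_charFn.add hD.summable_norm_charFn)⟩
  exact (congrArg norm (charFn_add hC.1 hD.1 a)).trans_le (norm_add_le _ _)

theorem smul (hC : HasWigner d C) (c : ℂ) : HasWigner d (c • C) := by
  refine ⟨hC.1.smul c, (hC.summable_norm_charFn.mul_left ‖c‖).congr fun a => ?_⟩
  rw [← norm_mul, ← charFn_smul, charFn]

theorem adjoint (hC : HasWigner d C) : HasWigner d (ContinuousLinearMap.adjoint C) := by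
  refine ⟨hC.1.adjoint, ((Equiv.neg _).summable_iff.2 hC.summable_norm_charFn).congr fun a => ?_⟩
  exact ((congrArg norm (charFn_adjoint hC.1 a)).trans (RCLike.norm_conj _)).symm

theorem disp_conj (hC : HasWigner d C) (b : Phase n) :
    HasWigner d (disp d b * C * ContinuousLinearMap.adjoint (disp d b)) := by
  refine ⟨(hC.1.mul_left _).mul_right _, hC.summable_norm_charFn.congr fun a => ?_⟩
  refine ((congrArg norm (charFn_disp_conj hC.1 b a)).trans ?_).symm
  rw [norm_mul, norm_phase, one_mul]

end HasWigner

variable {C D : Modes n →L[ℂ] Modes n}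

theorem wigner_add (hC : HasWigner d C) (hD : HasWigner d D) (η : Phase n) :
    wigner d (C + D) η = wigner d C η + wigner d D η := by
  rw [wigner_eq, wigner_eq, wigner_eq, ← mul_add,
    ← (hC.summable_phase_mul η).tsum_add (hD.summable_phase_mul η)]
  simp only [charFn_add hC.1 hD.1, mul_add]

theorem wigner_smul (c : ℂ) (C : Modes n →L[ℂ] Modes n) (η : Phase n) :
    wigner d (c • C) η = c * wigner d C η := by
  rw [wigner_eq, wigner_eq, mul_left_comm]
  simp only [charFn_smul, mul_left_comm _ c, tsum_mul_left]

theorem wigner_adjoint (hC : IsTraceClass C) (η : Phase n) :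
    wigner d (ContinuousLinearMap.adjoint C) η = starRingEnd ℂ (wigner d C η) := by
  rw [wigner_eq, wigner_eq, map_mul, Complex.conj_tsum, ← (Equiv.neg (Lattice n)).tsum_eq]
  congr 1
  · simp [Complex.conj_ofNat]
  · refine tsum_congr fun a => ?_
    rw [Equiv.neg_apply, charFn_adjoint hC, neg_neg, map_mul, map_mul, conj_phase,
      conj_latticeSign, latticeSign_neg, Lattice.toPhase_neg, symp_neg_left, mul_neg]

theorem wigner_disp_conj (hC : IsTraceClass C) (b η : Phase n) :
    wigner d (disp d b * C * ContinuousLinearMap.adjoint (disp d b)) η =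
      wigner d C (η - ell d • b) := by
  have hphase : ∀ a : Lattice n, ell d * symp a.toPhase (η - ell d • b) =
      ell d * symp a.toPhase η + -(2 * Real.pi * symp a.toPhase b / d) := fun a => by
    rw [sub_eq_add_neg, symp_add_right, symp_neg_right, symp_smul_right, mul_add, mul_neg,
      ← mul_assoc (ell d), ell_mul_ell]
    ring
  rw [wigner_eq, wigner_eq]
  simp only [charFn_disp_conj hC, hphase, phase_add]
  simp only [mul_left_comm, mul_assoc]

end Wigner

/-! ### Integrals of characters over boxes -/

/-- An integer vector regarded as a real vector, for an arbitrary index type; the components of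
`Lattice.toPhase a` are `intVec a.1` and `intVec a.2` by definition. -/
def intVec {ι : Type*} (p : ι → ℤ) : ι → ℝ := fun i => (p i : ℝ)

theorem intVec_add {ι : Type*} (p q : ι → ℤ) : intVec (p + q) = intVec p + intVec q := by
  ext
  simp [intVec]

theorem intVec_neg {ι : Type*} (p : ι → ℤ) : intVec (-p) = -intVec p := by
  ext
  simp [intVec]

theorem phase_intVec_dotProduct {ι : Type*} [Fintype ι] (p q : ι → ℤ) :
    phase (2 * Real.pi * (intVec p ⬝ᵥ intVec q)) = 1 := by
  rw [← phase_two_pi_mul_int (p ⬝ᵥ q)]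
  simp [intVec, dotProduct]

section Cube

variable (ι : Type*)

/-- The cube `[0, r)^ι`, half-open so that its translates by `r ℤ^ι` tile the space. -/
def cube (r : ℝ) : Set (ι → ℝ) := Set.univ.pi fun _ => Set.Ico 0 r

theorem measurableSet_cube [Countable ι] (r : ℝ) : MeasurableSet (cube ι r) :=
  MeasurableSet.univ_pi fun _ => measurableSet_Ico

variable [Fintype ι]

theorem volume_cube (r : ℝ) : volume (cube ι r) = ENNReal.ofReal r ^ Fintype.card ι := by
  rw [cube, Real.volume_pi_Ico]
  simp only [sub_zero, Finset.prod_const, Finset.card_univ]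

theorem volume_cube_ne_top (r : ℝ) : volume (cube ι r) ≠ ⊤ := by
  rw [volume_cube]
  exact ENNReal.pow_ne_top ENNReal.ofReal_ne_top

variable {ι}

theorem setIntegral_cube_prod (r : ℝ) (f : ι → ℝ → ℂ) :
    ∫ x in cube ι r, ∏ i, f i (x i) = ∏ i, ∫ x in Set.Ico 0 r, f i x := by
  rw [cube, volume_pi, Measure.restrict_pi_pi, integral_fintype_prod_eq_prod]

variable {c r : ℝ}

theorem setIntegral_Ico_phase (hcr : c * r = 2 * Real.pi) (hr : 0 < r) (m : ℤ) :
    ∫ x in Set.Ico 0 r, phase (c * (m * x)) = if m = 0 then (r : ℂ) else 0 := by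
  rw [integral_Ico_eq_integral_Ioc, ← intervalIntegral.integral_of_le hr.le]
  split_ifs with hm
  · simp [hm, phase_zero]
  · have hc : c ≠ 0 := left_ne_zero_of_mul (hcr.trans_ne Real.two_pi_pos.ne')
    have hexp : ∀ x : ℝ, phase (c * (m * x)) = Complex.exp (Complex.I * c * m * x) := fun x => by
      rw [phase]; push_cast; ring_nf
    have hper : c * (m * r) = 2 * Real.pi * m := by rw [← hcr]; ring
    simp only [hexp]
    rw [integral_exp_mul_complex (by simp [hc, hm]), ← hexp, ← hexp, mul_zero, mul_zero,
      phase_zero, hper, phase_two_pi_mul_int, sub_self, zero_div]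

theorem setIntegral_cube_phase (hcr : c * r = 2 * Real.pi) (hr : 0 < r) (m : ι → ℤ) :
    ∫ x in cube ι r, phase (c * (intVec m ⬝ᵥ x)) =
      if m = 0 then (r : ℂ) ^ Fintype.card ι else 0 := by
  simp only [dotProduct, intVec, Finset.mul_sum, phase_sum]
  rw [setIntegral_cube_prod r fun i x => phase (c * (m i * x))]
  simp only [setIntegral_Ico_phase hcr hr]
  split_ifs with hm
  · simp [hm, Finset.card_univ]
  · obtain ⟨i, hi⟩ := Function.ne_iff.1 hm
    exact Finset.prod_eq_zero (Finset.mem_univ i) (if_neg hi)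

end Cube

section Torus

variable {n d : ℕ}

theorem box_eq (n : ℕ) (r : ℝ) : box n r = cube (Fin n) r ×ˢ cube (Fin n) r := rfl

theorem volume_box_ne_top (n : ℕ) (r : ℝ) : volume (box n r) ≠ ⊤ := by
  rw [box_eq, Measure.volume_eq_prod, Measure.prod_prod]
  exact ENNReal.mul_ne_top (volume_cube_ne_top _ _) (volume_cube_ne_top _ _)

theorem setIntegral_box_phase {c r : ℝ} (hcr : c * r = 2 * Real.pi) (hr : 0 < r)
    (a : Lattice n) :
    ∫ η in box n r, phase (c * symp a.toPhase η) = if a = 0 then (r : ℂ) ^ (2 * n) else 0 := by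
  let char (m : Fin n → ℤ) (x : Fin n → ℝ) : ℂ := phase (c * (intVec m ⬝ᵥ x))
  have hsplit : ∀ η : Phase n, phase (c * symp a.toPhase η) = char (-a.2) η.1 * char a.1 η.2 := by
    intro η
    rw [← phase_add, ← mul_add, intVec_neg, neg_dotProduct, neg_add_eq_sub]
    rfl
  simp only [hsplit]
  rw [box_eq, Measure.volume_eq_prod, setIntegral_prod_mul (char (-a.2)) (char a.1),
    setIntegral_cube_phase hcr hr, setIntegral_cube_phase hcr hr, ite_zero_mul_ite_zero]
  simp only [Prod.ext_iff, Prod.fst_zero, Prod.snd_zero, neg_eq_zero, and_comm, two_mul, pow_add,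
    Fintype.card_fin]

theorem ell_mul_period (hd : 0 < d) : ell d * (d * ell d) = 2 * Real.pi := by
  rw [mul_left_comm, ell_mul_ell, mul_div_cancel₀ _ (Nat.cast_ne_zero.2 hd.ne')]

instance : IsFiniteMeasure (torusMeasure n d) := by
  have : IsFiniteMeasure (volume.restrict (box n (d * ell d))) :=
    isFiniteMeasure_restrict.2 (volume_box_ne_top _ _)
  exact Measure.smul_finite _ ENNReal.ofReal_ne_top

theorem integral_torus_phase (hd : 0 < d) (a : Lattice n) :
    ∫ η, phase (ell d * symp a.toPhase η) ∂torusMeasure n d =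
      if a = 0 then (2 * (Real.pi : ℂ)) ^ n else 0 := by
  have hd₀ : (d : ℂ) ≠ 0 := Nat.cast_ne_zero.2 hd.ne'
  have hperiod : ell d * (d * ell d : ℂ) = 2 * Real.pi := mod_cast ell_mul_period hd
  rw [torusMeasure, integral_smul_measure, setIntegral_box_phase (ell_mul_period hd)
    (mul_pos (Nat.cast_pos.2 hd) (ell_pos hd)), ENNReal.toReal_ofReal (by positivity), smul_ite,
    smul_zero, Complex.real_smul, ← hperiod]
  congr 1
  push_cast
  field_simp
  ring

@[fun_prop]
theorem continuous_symp (a : Phase n) : Continuous (symp a) := by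
  unfold symp dotProduct
  fun_prop

section FourierSeries

variable {ι : Type*} (g : ι → Lattice n) {s : ι → ℂ}

theorem integrable_tsum_phase_mul (hs : Summable s) :
    Integrable (fun η => ∑' i, phase (ell d * symp (g i).toPhase η) * s i) (torusMeasure n d) := by
  have hterm : ∀ i η, ‖phase (ell d * symp (g i).toPhase η) * s i‖ ≤ ‖s i‖ := fun i η => by
    rw [norm_mul, norm_phase, one_mul]
  refine Integrable.of_bound (C := ∑' i, ‖s i‖) ?_ (Filter.Eventually.of_forall fun η => ?_)
  · exact (continuous_tsum (fun i => by fun_prop) hs.norm hterm).aestronglyMeasurable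
  · exact tsum_of_norm_bounded hs.norm.hasSum fun i => hterm i η

theorem integral_tsum_phase_mul (hd : 0 < d) [Countable ι] (hs : Summable s) :
    ∫ η, ∑' i, phase (ell d * symp (g i).toPhase η) * s i ∂torusMeasure n d =
      (2 * (Real.pi : ℂ)) ^ n * ∑' i, if g i = 0 then s i else 0 := by
  rw [← integral_tsum_of_summable_integral_norm, ← tsum_mul_left]
  · refine tsum_congr fun i => ?_
    rw [integral_mul_const, integral_torus_phase hd]
    split_ifs <;> simp
  · intro i
    refine Integrable.of_bound (C := ‖s i‖) (Continuous.aestronglyMeasurable (by fun_prop))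
      (Filter.Eventually.of_forall fun η => ?_)
    rw [norm_mul, norm_phase, one_mul]
  · simp only [norm_mul, norm_phase, one_mul, integral_const]
    exact hs.norm.const_smul _

end FourierSeries

theorem tsum_ite_add_eq_zero {G α : Type*} [AddGroup G] [DecidableEq G] [NormedAddCommGroup α]
    [CompleteSpace α] {s : G × G → α} (hs : Summable fun p => ‖s p‖) :
    ∑' p : G × G, (if p.1 + p.2 = 0 then s p else 0) = ∑' a, s (-a, a) := by
  have hdiag : Summable fun p : G × G => if p.1 + p.2 = 0 then s p else 0 := by
    refine Summable.of_norm_bounded hs fun p => ?_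
    split_ifs <;> simp
  rw [hdiag.tsum_prod, ← (Equiv.neg G).tsum_eq]
  refine tsum_congr fun a => ?_
  rw [Equiv.neg_apply, tsum_eq_single a fun b hb => if_neg (mt neg_add_eq_zero.1 hb.symm),
    if_pos (neg_add_cancel a)]

/-- The pairing `(2π)⁻ⁿ ∑_a Tr (C T_{-a}) Tr (D T_a)` of two characteristic functions: the common
value of the four expressions in the traciality property. -/
def charPairing (d : ℕ) (C D : Modes n →L[ℂ] Modes n) : ℂ :=
  1 / (2 * (Real.pi : ℂ)) ^ n * ∑' a, charFn d C (-a) * charFn d D a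

theorem charPairing_comm (C D : Modes n →L[ℂ] Modes n) :
    charPairing d C D = charPairing d D C := by
  rw [charPairing, charPairing, ← (Equiv.neg (Lattice n)).tsum_eq]
  simp only [Equiv.neg_apply, neg_neg, mul_comm]

theorem two_pi_pow_ne_zero (n : ℕ) : (2 * (Real.pi : ℂ)) ^ n ≠ 0 :=
  pow_ne_zero n (mod_cast Real.two_pi_pos.ne')

namespace HasWigner

variable {C D : Modes n →L[ℂ] Modes n}

theorem summable_norm_latticeSign_mul (hC : HasWigner d C) :
    Summable fun a => ‖latticeSign a * charFn d C a‖ :=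
  hC.summable_norm_charFn.congr fun a => by rw [norm_mul, norm_latticeSign, one_mul]

theorem integrable_wigner (hC : HasWigner d C) : Integrable (wigner d C) (torusMeasure n d) := by
  simp only [funext (wigner_eq C)]
  exact (integrable_tsum_phase_mul _ hC.summable_norm_latticeSign_mul.of_norm).const_mul _

theorem integral_wigner (hd : 0 < d) (hC : HasWigner d C) :
    ∫ η, wigner d C η ∂torusMeasure n d = trace C := by
  simp only [wigner_eq]
  rw [integral_const_mul, integral_tsum_phase_mul (fun a => a) hd
    hC.summable_norm_latticeSign_mul.of_norm, ← mul_assoc,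
    one_div_mul_cancel (two_pi_pow_ne_zero n), one_mul, tsum_eq_single 0 fun a ha => if_neg ha,
    if_pos rfl, charFn_zero]
  simp [latticeSign, Lattice.toPhase_zero, phase_zero]

theorem wigner_mul (hC : HasWigner d C) (hD : HasWigner d D) (η : Phase n) :
    wigner d C η * wigner d D η =
      (1 / (2 * (Real.pi : ℂ)) ^ n * (1 / (2 * (Real.pi : ℂ)) ^ n)) *
        ∑' p : Lattice n × Lattice n, phase (ell d * symp (p.1 + p.2 : Lattice n).toPhase η) *
          (latticeSign p.1 * charFn d C p.1 * (latticeSign p.2 * charFn d D p.2)) := by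
  rw [wigner_eq, wigner_eq, mul_mul_mul_comm,
    tsum_mul_tsum_of_summable_norm (hC.summable_phase_mul η).norm (hD.summable_phase_mul η).norm]
  congr 1
  refine tsum_congr fun p => ?_
  rw [Lattice.toPhase_add, symp_add_left, mul_add, phase_add, mul_mul_mul_comm]

theorem integrable_wigner_mul (hC : HasWigner d C) (hD : HasWigner d D) :
    Integrable (fun η => wigner d C η * wigner d D η) (torusMeasure n d) := by
  simp only [hC.wigner_mul hD]
  exact (integrable_tsum_phase_mul _ (summable_mul_of_summable_norm
    hC.summable_norm_latticeSign_mul hD.summable_norm_latticeSign_mul)).const_mul _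

theorem integral_wigner_mul (hd : 0 < d) (hC : HasWigner d C) (hD : HasWigner d D) :
    ∫ η, wigner d C η * wigner d D η ∂torusMeasure n d = charPairing d C D := by
  have hs := summable_mul_of_summable_norm hC.summable_norm_latticeSign_mul
    hD.summable_norm_latticeSign_mul
  simp only [hC.wigner_mul hD]
  rw [integral_const_mul, integral_tsum_phase_mul (fun p : Lattice n × Lattice n => p.1 + p.2) hd
    hs, tsum_ite_add_eq_zero hs.norm, mul_assoc, ← mul_assoc (1 / _) (_ ^ n),
    one_div_mul_cancel (two_pi_pow_ne_zero n), one_mul, charPairing]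
  congr 1
  refine tsum_congr fun a => ?_
  rw [latticeSign_neg, mul_mul_mul_comm, latticeSign_mul_self, one_mul]

end HasWigner

end Torus

/-! ### The decomposition of space into cells -/

section Cells

variable {ι : Type*}

/-- The cube `r (p + [0, 1)^ι)` with an integer vector `p`, one of the tiles of space. -/
def cell (r : ℝ) (p : ι → ℤ) : Set (ι → ℝ) :=
  Set.univ.pi fun k => Set.Ico (r * p k) (r * (p k + 1))

theorem measurableSet_cell [Countable ι] (r : ℝ) (p : ι → ℤ) : MeasurableSet (cell r p) :=
  MeasurableSet.univ_pi fun _ => measurableSet_Ico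

variable {r : ℝ}

theorem mem_cell_iff_floor (hr : 0 < r) {p : ι → ℤ} {x : ι → ℝ} :
    x ∈ cell r p ↔ (fun k => ⌊x k / r⌋) = p := by
  simp only [cell, Set.mem_univ_pi, Set.mem_Ico, funext_iff, Int.floor_eq_iff, le_div_iff₀' hr,
    div_lt_iff₀' hr]

theorem pairwise_disjoint_cell (hr : 0 < r) :
    Pairwise fun p q : ι → ℤ => Disjoint (cell r p) (cell r q) := fun _ _ hpq =>
  Set.disjoint_left.2 fun _ hp hq =>
    hpq (((mem_cell_iff_floor hr).1 hp).symm.trans ((mem_cell_iff_floor hr).1 hq))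

theorem iUnion_cell (hr : 0 < r) : ⋃ p : ι → ℤ, cell r p = Set.univ :=
  Set.eq_univ_of_forall fun _ => Set.mem_iUnion.2 ⟨_, (mem_cell_iff_floor hr).2 rfl⟩

theorem smul_intVec_add_mem_cell_iff (hr : 0 < r) (p : ι → ℤ) (u : ι → ℝ) :
    r • (intVec p + u) ∈ cell r p ↔ u ∈ cube ι 1 := by
  simp only [cell, cube, Set.mem_univ_pi, intVec, Pi.smul_apply, Pi.add_apply, smul_eq_mul,
    Set.mem_Ico, mul_le_mul_iff_right₀ hr, mul_lt_mul_iff_right₀ hr, le_add_iff_nonneg_right,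
    add_lt_add_iff_left]

/-- A vector of residues modulo `d` regarded as an integer vector with entries in
`{0, …, d - 1}`. -/
def residueVec {d : ℕ} (j : ι → Fin d) : ι → ℤ := fun k => ((j k : ℕ) : ℤ)

theorem residueVec_injective {d : ℕ} : Function.Injective (residueVec : (ι → Fin d) → ι → ℤ) :=
  fun _ _ h => funext fun k => Fin.ext (Nat.cast_injective (congrFun h k))

theorem iUnion_cell_residueVec (hr : 0 < r) (d : ℕ) :
    ⋃ j : ι → Fin d, cell r (residueVec j) = cube ι (d * r) := by
  have hmem : ∀ x : ι → ℝ, x ∈ cube ι (d * r) ↔ ∀ k, 0 ≤ ⌊x k / r⌋ ∧ ⌊x k / r⌋ < d := fun x => by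
    simp only [cube, Set.mem_univ_pi, Set.mem_Ico, Int.floor_nonneg, Int.floor_lt,
      div_lt_iff₀ hr, Int.cast_natCast, le_div_iff₀ hr, zero_mul]
  ext x
  simp only [Set.mem_iUnion, mem_cell_iff_floor hr, hmem]
  constructor
  · rintro ⟨j, hj⟩ k
    rw [congrFun hj k]
    exact ⟨Int.natCast_nonneg _, Nat.cast_lt.2 (j k).2⟩
  · intro hx
    lift (fun k => ⌊x k / r⌋) to ι → ℕ using fun k => (hx k).1 with j hj
    have hlt : ∀ k, j k < d := fun k => by
      have := (hx k).2
      rwa [← congrFun hj k, Nat.cast_lt] at this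
    exact ⟨fun k => ⟨j k, hlt k⟩, rfl⟩

variable [Fintype ι]

theorem sum_setIntegral_cell [DecidableEq ι] (hr : 0 < r) {d : ℕ} {f : (ι → ℝ) → ℂ}
    (hf : IntegrableOn f (cube ι (d * r))) :
    ∑ j : ι → Fin d, ∫ x in cell r (residueVec j), f x = ∫ x in cube ι (d * r), f x := by
  rw [← iUnion_cell_residueVec hr] at hf ⊢
  exact (integral_iUnion_fintype (fun j => measurableSet_cell r _)
    ((pairwise_disjoint_cell hr).comp_of_injective residueVec_injective)
    fun j => hf.mono_set (Set.subset_iUnion (fun j => cell r (residueVec j)) j)).symm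

theorem setIntegral_cell (hr : 0 < r) (f : (ι → ℝ) → ℂ) (p : ι → ℤ) :
    ∫ x in cell r p, f x =
      ((r ^ Fintype.card ι : ℝ) : ℂ) * ∫ u in cube ι 1, f (r • (intVec p + u)) := by
  have hindicator : ∀ u, (cell r p).indicator f (r • (intVec p + u)) =
      (cube ι 1).indicator (fun u => f (r • (intVec p + u))) u := fun u => by
    classical
    rw [Set.indicator_apply, Set.indicator_apply]
    exact if_congr (smul_intVec_add_mem_cell_iff hr p u) rfl rfl
  have hscale := Measure.integral_comp_smul (volume : Measure (ι → ℝ)) ((cell r p).indicator f) r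
  rw [← integral_add_left_eq_self _ (intVec p), integral_indicator (measurableSet_cell r p),
    Module.finrank_fintype_fun_eq_card, abs_of_nonneg (by positivity)] at hscale
  simp only [hindicator] at hscale
  rw [integral_indicator (measurableSet_cube ι 1)] at hscale
  rw [hscale, Complex.real_smul, ← mul_assoc, ← Complex.ofReal_mul,
    mul_inv_cancel₀ (pow_pos hr _).ne', Complex.ofReal_one, one_mul]

end Cells

/-! ### The trace per stabilizer of a displacement -/

section CellTrace

variable {n d : ℕ}

theorem posCell_eq_cell (j : Fin n → Fin d) : posCell d j = cell (ell d) (residueVec j) := by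
  simp [posCell, cell, residueVec]

theorem sub_smul_intVec_notMem_cell {ι : Type*} {r : ℝ} (hr : 0 < r) {p m : ι → ℤ} {x : ι → ℝ}
    (hm : m ≠ 0) (hx : x ∈ cell r p) : x - r • intVec m ∉ cell r p := by
  intro hx'
  rw [mem_cell_iff_floor hr] at hx hx'
  refine hm (funext fun k => ?_)
  have hfloor : ⌊(x k - r * m k) / r⌋ = ⌊x k / r⌋ := congrFun (hx'.trans hx.symm) k
  rw [sub_div, mul_div_cancel_left₀ _ hr.ne', Int.floor_sub_intCast] at hfloor
  simpa using hfloor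

theorem coeFn_disp_cellVec (hd : 0 < d) (a : Lattice n) (j : Fin n → Fin d) :
    ∀ᵐ q, q ∈ posCell d j → disp d a.toPhase (cellVec d j) q = if a.1 = 0 then
      (((Real.sqrt (ell d))⁻¹ ^ n : ℝ) : ℂ) * phase (ell d * (intVec a.2 ⬝ᵥ q)) else 0 := by
  filter_upwards [coeFn_disp d a.toPhase (cellVec d j),
    dispFun_congr d a.toPhase (indicatorConstLp_coeFn (p := 2) (hs := measurableSet_posCell d j)
      (hμs := volume_posCell_ne_top d j) (c := (((Real.sqrt (ell d))⁻¹ ^ n : ℝ) : ℂ)))]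
    with q hdisp hindicator hq
  rw [hdisp, cellVec, hindicator, dispFun_eq]
  split_ifs with ha
  · have hx : a.toPhase.1 = 0 := by
      ext k
      simp [Lattice.toPhase, ha]
    rw [hx, smul_zero, sub_zero, Set.indicator_of_mem hq, zero_dotProduct, mul_zero, zero_div,
      sub_zero, mul_comm]
    rfl
  · rw [Set.indicator_of_notMem, mul_zero]
    rw [posCell_eq_cell] at hq ⊢
    exact sub_smul_intVec_notMem_cell (ell_pos hd) ha hq

theorem inner_cellVec_disp (hd : 0 < d) (a : Lattice n) (j : Fin n → Fin d) :
    ⟪cellVec d j, disp d a.toPhase (cellVec d j)⟫_ℂ =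
      if a.1 = 0 then (((ell d)⁻¹ ^ n : ℝ) : ℂ) *
        ∫ q in cell (ell d) (residueVec j), phase (ell d * (intVec a.2 ⬝ᵥ q)) else 0 := by
  nth_rw 1 [cellVec]
  rw [L2.inner_indicatorConstLp_eq_inner_setIntegral,
    setIntegral_congr_ae (measurableSet_posCell d j) (coeFn_disp_cellVec hd a j), posCell_eq_cell]
  split_ifs
  · rw [integral_const_mul, RCLike.inner_apply, Complex.conj_ofReal, mul_right_comm,
      ← Complex.ofReal_mul, ← mul_pow, ← mul_inv, Real.mul_self_sqrt (ell_pos hd).le]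
  · rw [integral_zero, inner_zero_right]

theorem cellTrace_disp (hd : 0 < d) (a : Lattice n) :
    cellTrace d (disp d a.toPhase) = if a = 0 then (2 * (Real.pi : ℂ)) ^ n else 0 := by
  have hl := ell_pos hd
  have hd₀ : (0 : ℝ) < d := Nat.cast_pos.2 hd
  have hnorm : (2 * Real.pi / d) * ((ell d)⁻¹ * (d * ell d)) = 2 * Real.pi := by field_simp
  have hint : IntegrableOn (fun q => phase (ell d * (intVec a.2 ⬝ᵥ q)))
      (cube (Fin n) (d * ell d)) := by
    refine Measure.integrableOn_of_bounded (M := 1) (volume_cube_ne_top _ _) ?_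
      (Filter.Eventually.of_forall fun q => (norm_phase _).le)
    refine Continuous.aestronglyMeasurable ?_
    unfold dotProduct
    fun_prop
  simp only [cellTrace, inner_cellVec_disp hd]
  by_cases hx : a.1 = 0
  · simp only [if_pos hx]
    rw [← Finset.mul_sum, sum_setIntegral_cell hl hint, setIntegral_cube_phase (ell_mul_period hd)
      (mul_pos hd₀ hl), mul_ite, mul_ite, mul_zero, mul_zero, Fintype.card_fin]
    simp only [Prod.ext_iff, Prod.fst_zero, Prod.snd_zero, hx, true_and]
    congr 1
    exact_mod_cast (by rw [← mul_pow, ← mul_pow, hnorm] :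
      (2 * Real.pi / d) ^ n * ((ell d)⁻¹ ^ n * (d * ell d) ^ n) = (2 * Real.pi) ^ n)
  · simp [hx, Prod.ext_iff]

end CellTrace

/-! ### Parseval's identity on the unit cube -/

section Parseval

variable {ι : Type*}

-- The same local instance as in Mathlib's theory of Fourier series on `UnitAddTorus`.
local instance : MeasureSpace UnitAddCircle := ⟨AddCircle.haarAddCircle⟩

/-- The coordinates in the cube `(0, 1]^ι` of a point of the torus; they carry Mathlib's Fourier
series on the torus over to the cube. -/
def torusCoord (ι : Type*) (y : UnitAddTorus ι) : ι → ℝ :=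
  (UnitAddTorus.measurableEquivPiIoc (fun _ : ι => (0 : ℝ)) y).1

theorem coe_torusCoord (y : UnitAddTorus ι) (i : ι) : (torusCoord ι y i : UnitAddCircle) = y i :=
  congrFun ((UnitAddTorus.measurableEquivPiIoc fun _ : ι => (0 : ℝ)).symm_apply_apply y) i

theorem measurableEmbedding_torusCoord [Countable ι] : MeasurableEmbedding (torusCoord ι) :=
  (MeasurableEmbedding.subtype_coe (MeasurableSet.univ_pi' fun _ => measurableSet_Ioc)).comp
    (UnitAddTorus.measurableEquivPiIoc fun _ : ι => (0 : ℝ)).measurableEmbedding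

/-- The unit box `[0, 1)^ι × [0, 1)^ι`, the fundamental domain for Zak transforms; it is
`box n 1` for `ι = Fin n`, by definition. -/
def unitBox (ι : Type*) : Set ((ι → ℝ) × (ι → ℝ)) := cube ι 1 ×ˢ cube ι 1

theorem measurableSet_unitBox [Countable ι] : MeasurableSet (unitBox ι) :=
  (measurableSet_cube ι 1).prod (measurableSet_cube ι 1)

variable [Fintype ι]

theorem restrict_Ioc_eq_restrict_cube :
    (volume : Measure (ι → ℝ)).restrict {x | ∀ i, x i ∈ Set.Ioc (0 : ℝ) (0 + 1)} =
      volume.restrict (cube ι 1) := by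
  refine Measure.restrict_congr_set ?_
  have hpi : {x : ι → ℝ | ∀ i, x i ∈ Set.Ioc (0 : ℝ) (0 + 1)} =
      Set.univ.pi fun i => Set.Ioc ((0 : ι → ℝ) i) ((1 : ι → ℝ) i) := by
    ext x
    simp
  rw [hpi]
  exact (Measure.univ_pi_Ioc_ae_eq_Icc (μ := fun _ : ι => (volume : Measure ℝ))).trans
    (Measure.univ_pi_Ico_ae_eq_Icc (μ := fun _ : ι => (volume : Measure ℝ))).symm

theorem measurePreserving_torusCoord :
    MeasurePreserving (torusCoord ι) volume (volume.restrict (cube ι 1)) := by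
  rw [← restrict_Ioc_eq_restrict_cube]
  exact (measurePreserving_subtype_coe
    (MeasurableSet.univ_pi' fun _ => measurableSet_Ioc)).comp
    (UnitAddTorus.measurePreserving_equivPiIoc fun _ : ι => (0 : ℝ))

theorem mFourier_eq_phase (m : ι → ℤ) (y : UnitAddTorus ι) :
    UnitAddTorus.mFourier m y = phase (2 * Real.pi * (intVec m ⬝ᵥ torusCoord ι y)) := by
  simp only [UnitAddTorus.mFourier, ContinuousMap.coe_mk, dotProduct, Finset.mul_sum, phase_sum]
  refine Finset.prod_congr rfl fun i _ => ?_
  rw [← coe_torusCoord y i, fourier_coe_apply, phase, intVec]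
  push_cast
  congr 1
  ring

theorem mFourierCoeff_comp_torusCoord {f : (ι → ℝ) → ℂ}
    (hf : MemLp (f ∘ torusCoord ι) 2 volume) (m : ι → ℤ) :
    UnitAddTorus.mFourierCoeff (hf.toLp _) m =
      ∫ x in cube ι 1, phase (2 * Real.pi * (intVec (-m) ⬝ᵥ x)) * f x := by
  rw [← measurePreserving_torusCoord.integral_comp measurableEmbedding_torusCoord]
  refine integral_congr_ae ?_
  filter_upwards [hf.coeFn_toLp] with y hy
  rw [hy, mFourier_eq_phase]
  rfl

theorem hasSum_parseval_cube {f g : (ι → ℝ) → ℂ} (hf : MemLp f 2 (volume.restrict (cube ι 1)))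
    (hg : MemLp g 2 (volume.restrict (cube ι 1))) :
    HasSum (fun m : ι → ℤ =>
      (∫ x in cube ι 1, phase (2 * Real.pi * (intVec m ⬝ᵥ x)) * f x) *
        starRingEnd ℂ (∫ x in cube ι 1, phase (2 * Real.pi * (intVec m ⬝ᵥ x)) * g x))
      (∫ x in cube ι 1, f x * starRingEnd ℂ (g x)) := by
  have hf' := hf.comp_measurePreserving (measurePreserving_torusCoord (ι := ι))
  have hg' := hg.comp_measurePreserving (measurePreserving_torusCoord (ι := ι))
  have hparseval := UnitAddTorus.hasSum_prod_mFourierCoeff (hg'.toLp _) (hf'.toLp _)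
  have hinner : ∫ t, starRingEnd ℂ (hg'.toLp _ t) * hf'.toLp _ t =
      ∫ x in cube ι 1, f x * starRingEnd ℂ (g x) := by
    rw [← measurePreserving_torusCoord.integral_comp measurableEmbedding_torusCoord]
    refine integral_congr_ae ?_
    filter_upwards [hf'.coeFn_toLp, hg'.coeFn_toLp] with y hfy hgy
    rw [hfy, hgy, mul_comm]
    rfl
  rw [← (Equiv.neg (ι → ℤ)).hasSum_iff, hinner] at hparseval
  refine hparseval.congr_fun fun m => ?_
  rw [Function.comp_apply, Equiv.neg_apply, mFourierCoeff_comp_torusCoord,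
    mFourierCoeff_comp_torusCoord, neg_neg, mul_comm]

instance : IsFiniteMeasure (volume.restrict (unitBox ι)) :=
  isFiniteMeasure_restrict.2 (by
    rw [unitBox, Measure.volume_eq_prod, Measure.prod_prod]
    exact ENNReal.mul_ne_top (volume_cube_ne_top ι 1) (volume_cube_ne_top ι 1))

theorem hasSum_parseval_unitBox {f g : (ι → ℝ) × (ι → ℝ) → ℂ}
    (hf : MemLp f 2 (volume.restrict (unitBox ι))) (hg : MemLp g 2 (volume.restrict (unitBox ι))) :
    HasSum (fun m : (ι → ℤ) × (ι → ℤ) =>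
      (∫ x in unitBox ι,
        phase (2 * Real.pi * (intVec m.1 ⬝ᵥ x.1 + intVec m.2 ⬝ᵥ x.2)) * f x) *
      starRingEnd ℂ (∫ x in unitBox ι,
        phase (2 * Real.pi * (intVec m.1 ⬝ᵥ x.1 + intVec m.2 ⬝ᵥ x.2)) * g x))
      (∫ x in unitBox ι, f x * starRingEnd ℂ (g x)) := by
  let e := MeasurableEquiv.sumPiEquivProdPi fun _ : ι ⊕ ι => ℝ
  have hpre : e ⁻¹' unitBox ι = cube (ι ⊕ ι) 1 := by
    ext x
    simp only [Set.mem_preimage, unitBox, cube, Set.mem_prod, Set.mem_univ_pi, Sum.forall]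
    rfl
  have he : MeasurePreserving e (volume.restrict (cube (ι ⊕ ι) 1))
      (volume.restrict (unitBox ι)) := by
    rw [← hpre]
    exact (volume_measurePreserving_sumPiEquivProdPi fun _ : ι ⊕ ι => ℝ).restrict_preimage
      measurableSet_unitBox
  have hparseval :=
    hasSum_parseval_cube (hf.comp_measurePreserving he) (hg.comp_measurePreserving he)
  rw [← (Equiv.sumArrowEquivProdArrow ι ι ℤ).symm.hasSum_iff] at hparseval
  rw [← he.integral_comp e.measurableEmbedding]
  refine hparseval.congr_fun fun m => ?_
  have hdot : ∀ x : ι ⊕ ι → ℝ,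
      intVec ((Equiv.sumArrowEquivProdArrow ι ι ℤ).symm m) ⬝ᵥ x =
        intVec m.1 ⬝ᵥ (e x).1 + intVec m.2 ⬝ᵥ (e x).2 := fun x => by
    simp only [dotProduct, Fintype.sum_sum_type]
    rfl
  simp only [Function.comp_apply, hdot]
  rw [← he.integral_comp e.measurableEmbedding, ← he.integral_comp e.measurableEmbedding]

end Parseval

/-! ### The Zak transform -/

section Zak

variable {ι : Type*}

/-- The functions of the Wiener space: continuous functions whose suprema over the integer
translates of the unit cube are summable. Their Zak transforms converge absolutely. -/
structure IsWiener (A : (ι → ℝ) → ℂ) : Prop where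
  continuous : Continuous A
  exists_bound : ∃ c : (ι → ℤ) → ℝ, Summable c ∧
    ∀ p, ∀ t ∈ cube ι 1, ‖A (t + intVec p)‖ ≤ c p

theorem cell_one (p : ι → ℤ) : cell 1 p = (· + intVec p) '' cube ι 1 := by
  ext x
  have hmem := smul_intVec_add_mem_cell_iff one_pos p (x - intVec p)
  rw [add_sub_cancel, one_smul] at hmem
  simp [hmem, sub_eq_add_neg]

namespace IsWiener

variable {A B : (ι → ℝ) → ℂ}

theorem exists_norm_le (hA : IsWiener A) : ∃ M, ∀ x, ‖A x‖ ≤ M := by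
  obtain ⟨c, hc, hAc⟩ := hA.exists_bound
  have hc₀ : ∀ p, 0 ≤ c p := fun p => (norm_nonneg _).trans (hAc p 0 fun _ _ => by simp)
  refine ⟨∑' p, c p, fun x => ?_⟩
  obtain ⟨p, hp⟩ := Set.mem_iUnion.1 ((iUnion_cell one_pos).ge (Set.mem_univ x))
  rw [cell_one] at hp
  obtain ⟨t, ht, rfl⟩ := hp
  exact (hAc p t ht).trans (hc.le_tsum p fun q _ => hc₀ q)

theorem mul_bounded (hA : IsWiener A) (hB : Continuous B) {M : ℝ} (hM : ∀ x, ‖B x‖ ≤ M) :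
    IsWiener fun x => A x * B x := by
  obtain ⟨c, hc, hAc⟩ := hA.exists_bound
  refine ⟨hA.continuous.mul hB, fun p => c p * M, hc.mul_right M, fun p t ht => ?_⟩
  rw [norm_mul]
  exact mul_le_mul (hAc p t ht) (hM _) (norm_nonneg _) ((norm_nonneg _).trans (hAc p t ht))

theorem conj (hA : IsWiener A) : IsWiener fun x => starRingEnd ℂ (A x) := by
  obtain ⟨c, hc, hAc⟩ := hA.exists_bound
  exact ⟨Complex.continuous_conj.comp hA.continuous, c, hc, fun p t ht =>
    (RCLike.norm_conj _).trans_le (hAc p t ht)⟩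

end IsWiener

variable [Fintype ι]

/-- The term of index `p` of the series defining the Zak transform. -/
def zakTerm (A : (ι → ℝ) → ℂ) (p : ι → ℤ) (x : (ι → ℝ) × (ι → ℝ)) : ℂ :=
  phase (-(2 * Real.pi * (x.2 ⬝ᵥ intVec p))) * A (x.1 + intVec p)

/-- The Zak transform `Z A (t, v) = ∑_p exp (-2πi v ⬝ p) A (t + p)`: pairings with GKP states are
its values. -/
def zak (A : (ι → ℝ) → ℂ) (x : (ι → ℝ) × (ι → ℝ)) : ℂ := ∑' p, zakTerm A p x

/-- The product `conj (Z A) * Z B` of two Zak transforms, the local form of the GKP projectors. It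
is `1`-periodic in the first variable, whereas `Z A` and `Z B` are only quasi-periodic. -/
def zakProd (A B : (ι → ℝ) → ℂ) (x : (ι → ℝ) × (ι → ℝ)) : ℂ :=
  starRingEnd ℂ (zak A x) * zak B x

/-- The cross-ambiguity function `∫ conj (f q) exp (i z ⬝ q) g (q - x) dq`: up to a constant phase,
the matrix element between `f` and `g` of the displacement by `x` in position and `z` in
momentum. -/
def ambiguity (f g : (ι → ℝ) → ℂ) (x z : ι → ℝ) : ℂ :=
  ∫ q, starRingEnd ℂ (f q) * (phase (z ⬝ᵥ q) * g (q - x))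

theorem norm_zakTerm (A : (ι → ℝ) → ℂ) (p : ι → ℤ) (x : (ι → ℝ) × (ι → ℝ)) :
    ‖zakTerm A p x‖ = ‖A (x.1 + intVec p)‖ := by
  rw [zakTerm, norm_mul, norm_phase, one_mul]

namespace IsWiener

variable {A B : (ι → ℝ) → ℂ}

theorem integrable (hA : IsWiener A) : Integrable A := by
  obtain ⟨c, hc, hAc⟩ := hA.exists_bound
  have hvolume : ∀ p : ι → ℤ, volume (cell 1 p) = 1 := fun p => by
    rw [cell_one, Set.image_add_right, measure_preimage_add_right, volume_cube, ENNReal.ofReal_one,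
      one_pow]
  have hbound : ∀ p, ∀ x ∈ cell 1 p, ‖A x‖ ≤ c p := fun p x hx => by
    rw [cell_one] at hx
    obtain ⟨t, ht, rfl⟩ := hx
    exact hAc p t ht
  have hint : ∀ p, IntegrableOn A (cell 1 p) := fun p =>
    Measure.integrableOn_of_bounded (M := c p) (by simp [hvolume])
      hA.continuous.aestronglyMeasurable
      (ae_restrict_of_forall_mem (measurableSet_cell 1 p) (hbound p))
  rw [← integrableOn_univ, ← iUnion_cell one_pos]
  refine integrableOn_iUnion_of_summable_integral_norm hint
    (hc.of_nonneg_of_le (fun p => integral_nonneg fun _ => norm_nonneg _) fun p => ?_)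
  have hmono := setIntegral_mono_on (hint p).norm (integrableOn_const (by simp [hvolume]))
    (measurableSet_cell 1 p) (hbound p)
  simpa [Measure.real, hvolume] using hmono

theorem hasSum_setIntegral (hA : IsWiener A) :
    HasSum (fun p => ∫ t in cube ι 1, A (t + intVec p)) (∫ x, A x) := by
  have hsum := hasSum_integral_iUnion (measurableSet_cell 1) (pairwise_disjoint_cell one_pos)
    (hA.integrable.integrableOn (s := ⋃ p, cell 1 p))
  rw [iUnion_cell one_pos, setIntegral_univ] at hsum
  refine hsum.congr_fun fun p => ?_
  simp [setIntegral_cell one_pos, add_comm]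

theorem exists_zakTerm_bound (hA : IsWiener A) : ∃ c : (ι → ℤ) → ℝ, Summable c ∧ (∀ p, 0 ≤ c p) ∧
    ∀ p, ∀ x ∈ unitBox ι, ‖zakTerm A p x‖ ≤ c p := by
  obtain ⟨c, hc, hAc⟩ := hA.exists_bound
  refine ⟨c, hc, fun p => (norm_nonneg _).trans (hAc p 0 fun _ _ => by simp), fun p x hx => ?_⟩
  rw [norm_zakTerm]
  exact hAc p _ hx.1

theorem continuous_zakTerm (hA : IsWiener A) (p : ι → ℤ) : Continuous (zakTerm A p) := by
  have := hA.continuous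
  unfold zakTerm
  fun_prop

theorem summable_norm_zakTerm (hA : IsWiener A) {x : (ι → ℝ) × (ι → ℝ)} (hx : x ∈ unitBox ι) :
    Summable fun p => ‖zakTerm A p x‖ := by
  obtain ⟨c, hc, -, hAc⟩ := hA.exists_zakTerm_bound
  exact hc.of_nonneg_of_le (fun _ => norm_nonneg _) fun p => hAc p x hx

theorem exists_norm_zak_le (hA : IsWiener A) : ∃ M, ∀ x ∈ unitBox ι, ‖zak A x‖ ≤ M := by
  obtain ⟨c, hc, -, hAc⟩ := hA.exists_zakTerm_bound
  exact ⟨∑' p, c p, fun x hx => tsum_of_norm_bounded hc.hasSum fun p => hAc p x hx⟩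

theorem continuousOn_zak (hA : IsWiener A) : ContinuousOn (zak A) (unitBox ι) := by
  obtain ⟨c, hc, -, hAc⟩ := hA.exists_zakTerm_bound
  exact continuousOn_tsum (fun p => (hA.continuous_zakTerm p).continuousOn) hc hAc

theorem memLp_zak_comp (hA : IsWiener A) {τ : (ι → ℝ) × (ι → ℝ) → (ι → ℝ) × (ι → ℝ)}
    (hτ : ContinuousOn τ (unitBox ι)) (hmaps : Set.MapsTo τ (unitBox ι) (unitBox ι)) :
    MemLp (fun x => zak A (τ x)) ⊤ (volume.restrict (unitBox ι)) := by
  obtain ⟨M, hM⟩ := hA.exists_norm_zak_le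
  exact memLp_top_of_bound
    ((hA.continuousOn_zak.comp hτ hmaps).aestronglyMeasurable measurableSet_unitBox) M
    (ae_restrict_of_forall_mem measurableSet_unitBox fun x hx => hM _ (hmaps hx))

theorem memLp_zakProd_comp (hA : IsWiener A) (hB : IsWiener B)
    {τ : (ι → ℝ) × (ι → ℝ) → (ι → ℝ) × (ι → ℝ)}
    (hτ : ContinuousOn τ (unitBox ι)) (hmaps : Set.MapsTo τ (unitBox ι) (unitBox ι)) :
    MemLp (fun x => zakProd A B (τ x)) ⊤ (volume.restrict (unitBox ι)) :=
  MemLp.mul (p := ⊤) (q := ⊤) (hB.memLp_zak_comp hτ hmaps) (hA.memLp_zak_comp hτ hmaps).star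

theorem memLp_zakProd (hA : IsWiener A) (hB : IsWiener B) :
    MemLp (zakProd A B) ⊤ (volume.restrict (unitBox ι)) :=
  hA.memLp_zakProd_comp hB continuousOn_id (Set.mapsTo_id _)

theorem hasSum_zakProd (hA : IsWiener A) (hB : IsWiener B) {x : (ι → ℝ) × (ι → ℝ)}
    (hx : x ∈ unitBox ι) :
    HasSum (fun p : (ι → ℤ) × (ι → ℤ) => starRingEnd ℂ (zakTerm A p.1 x) * zakTerm B p.2 x)
      (zakProd A B x) := by
  have hAx : Summable fun p => ‖starRingEnd ℂ (zakTerm A p x)‖ := by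
    simpa only [RCLike.norm_conj] using hA.summable_norm_zakTerm hx
  have hBx := hB.summable_norm_zakTerm hx
  rw [zakProd, zak, zak, Complex.conj_tsum, tsum_mul_tsum_of_summable_norm hAx hBx]
  exact (summable_mul_of_summable_norm hAx hBx).hasSum

theorem hasSum_setIntegral_zakTerm (hA : IsWiener A) (hB : IsWiener B)
    {χ : (ι → ℝ) × (ι → ℝ) → ℂ} (hχ : Continuous χ) (hχ_norm : ∀ x, ‖χ x‖ = 1) :
    HasSum (fun p : (ι → ℤ) × (ι → ℤ) => ∫ x in unitBox ι,
        χ x * (starRingEnd ℂ (zakTerm A p.1 x) * zakTerm B p.2 x))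
      (∫ x in unitBox ι, χ x * zakProd A B x) := by
  obtain ⟨c, hc, hc₀, hAc⟩ := hA.exists_zakTerm_bound
  obtain ⟨c', hc', hc'₀, hBc'⟩ := hB.exists_zakTerm_bound
  refine hasSum_integral_of_dominated_convergence (fun p _ => c p.1 * c' p.2)
    (fun p => (hχ.mul ((Complex.continuous_conj.comp (hA.continuous_zakTerm p.1)).mul
      (hB.continuous_zakTerm p.2))).aestronglyMeasurable)
    (fun p => ae_restrict_of_forall_mem measurableSet_unitBox fun x hx => ?_)
    (Filter.Eventually.of_forall fun _ => hc.mul_of_nonneg hc' hc₀ hc'₀) (integrable_const _)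
    (ae_restrict_of_forall_mem measurableSet_unitBox fun x hx =>
      (hA.hasSum_zakProd hB hx).mul_left _)
  rw [norm_mul, norm_mul, hχ_norm, one_mul, RCLike.norm_conj]
  exact mul_le_mul (hAc _ x hx) (hBc' _ x hx) (norm_nonneg _) (hc₀ _)

end IsWiener

theorem phase_mul_conj_zakTerm_mul_zakTerm (A B : (ι → ℝ) → ℂ) (a p : (ι → ℤ) × (ι → ℤ))
    (x : (ι → ℝ) × (ι → ℝ)) :
    phase (2 * Real.pi * (intVec a.1 ⬝ᵥ x.1 + intVec a.2 ⬝ᵥ x.2)) *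
        (starRingEnd ℂ (zakTerm A p.1 x) * zakTerm B p.2 x) =
      phase (2 * Real.pi * (intVec a.1 ⬝ᵥ x.1)) *
          (starRingEnd ℂ (A (x.1 + intVec p.1)) * B (x.1 + intVec p.2)) *
        phase (2 * Real.pi * (intVec (p.1 + a.2 + -p.2) ⬝ᵥ x.2)) := by
  have hphase : 2 * Real.pi * (intVec (p.1 + a.2 + -p.2) ⬝ᵥ x.2) =
      2 * Real.pi * (intVec a.2 ⬝ᵥ x.2) + 2 * Real.pi * (x.2 ⬝ᵥ intVec p.1) +
        -(2 * Real.pi * (x.2 ⬝ᵥ intVec p.2)) := by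
    rw [intVec_add, intVec_add, intVec_neg, add_dotProduct, add_dotProduct, neg_dotProduct,
      dotProduct_comm x.2, dotProduct_comm x.2]
    ring
  rw [zakTerm, zakTerm, map_mul, conj_phase, neg_neg, mul_add, phase_add, hphase, phase_add,
    phase_add]
  ring

theorem setIntegral_phase_mul_zakTerm (A B : (ι → ℝ) → ℂ) (a p : (ι → ℤ) × (ι → ℤ)) :
    ∫ x in unitBox ι, phase (2 * Real.pi * (intVec a.1 ⬝ᵥ x.1 + intVec a.2 ⬝ᵥ x.2)) *
        (starRingEnd ℂ (zakTerm A p.1 x) * zakTerm B p.2 x) =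
      if p.2 = p.1 + a.2 then ∫ t in cube ι 1, starRingEnd ℂ (A (t + intVec p.1)) *
        (phase ((2 * Real.pi) • intVec a.1 ⬝ᵥ (t + intVec p.1)) *
          B (t + intVec p.1 - -intVec a.2)) else 0 := by
  simp only [phase_mul_conj_zakTerm_mul_zakTerm]
  rw [unitBox, Measure.volume_eq_prod, setIntegral_prod_mul
      (fun t => phase (2 * Real.pi * (intVec a.1 ⬝ᵥ t)) *
        (starRingEnd ℂ (A (t + intVec p.1)) * B (t + intVec p.2)))
      (fun v => phase (2 * Real.pi * (intVec (p.1 + a.2 + -p.2) ⬝ᵥ v))),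
    setIntegral_cube_phase (mul_one _) one_pos, Complex.ofReal_one, one_pow, mul_ite, mul_one,
    mul_zero]
  refine ite_congr (propext (add_neg_eq_zero.trans eq_comm)) (fun hp => ?_) fun _ => rfl
  refine integral_congr_ae (Filter.Eventually.of_forall fun t => ?_)
  beta_reduce
  rw [smul_dotProduct, smul_eq_mul, dotProduct_add, mul_add, phase_add, phase_intVec_dotProduct,
    mul_one, sub_neg_eq_add, hp, intVec_add, add_assoc]
  exact mul_left_comm _ _ _

namespace IsWiener

variable {A B A' B' : (ι → ℝ) → ℂ}

theorem setIntegral_phase_mul_zakProd (hA : IsWiener A) (hB : IsWiener B) (a : (ι → ℤ) × (ι → ℤ)) :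
    ∫ x in unitBox ι, phase (2 * Real.pi * (intVec a.1 ⬝ᵥ x.1 + intVec a.2 ⬝ᵥ x.2)) *
        zakProd A B x =
      ambiguity A B (-intVec a.2) ((2 * Real.pi) • intVec a.1) := by
  obtain ⟨M, hM⟩ := hB.exists_norm_le
  have hB_cont := hB.continuous
  have hproduct : IsWiener fun t => starRingEnd ℂ (A t) *
      (phase ((2 * Real.pi) • intVec a.1 ⬝ᵥ t) * B (t - -intVec a.2)) :=
    hA.conj.mul_bounded (by fun_prop) fun t => by
      rw [norm_mul, norm_phase, one_mul]
      exact hM _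
  have hsum := hA.hasSum_setIntegral_zakTerm hB
    (χ := fun x => phase (2 * Real.pi * (intVec a.1 ⬝ᵥ x.1 + intVec a.2 ⬝ᵥ x.2)))
    (by fun_prop) fun _ => norm_phase _
  have hfiber : ∀ p : ι → ℤ, HasSum (fun q => ∫ x in unitBox ι,
      phase (2 * Real.pi * (intVec a.1 ⬝ᵥ x.1 + intVec a.2 ⬝ᵥ x.2)) *
        (starRingEnd ℂ (zakTerm A p x) * zakTerm B q x))
      (∫ t in cube ι 1, starRingEnd ℂ (A (t + intVec p)) *
        (phase ((2 * Real.pi) • intVec a.1 ⬝ᵥ (t + intVec p)) *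
          B (t + intVec p - -intVec a.2))) := fun p => by
    simp only [setIntegral_phase_mul_zakTerm A B a (p, _)]
    exact hasSum_ite_eq (p + a.2) _
  exact (hsum.prod_fiberwise hfiber).unique hproduct.hasSum_setIntegral

theorem hasSum_ambiguity_mul_conj (hA : IsWiener A) (hB : IsWiener B) (hA' : IsWiener A')
    (hB' : IsWiener B') :
    HasSum (fun a : (ι → ℤ) × (ι → ℤ) =>
        ambiguity A B (-intVec a.2) ((2 * Real.pi) • intVec a.1) *
          starRingEnd ℂ (ambiguity A' B' (-intVec a.2) ((2 * Real.pi) • intVec a.1)))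
      (∫ x in unitBox ι, zakProd A B x * starRingEnd ℂ (zakProd A' B' x)) := by
  simp only [← hA.setIntegral_phase_mul_zakProd hB, ← hA'.setIntegral_phase_mul_zakProd hB']
  exact hasSum_parseval_unitBox ((hA.memLp_zakProd hB).mono_exponent le_top)
    ((hA'.memLp_zakProd hB').mono_exponent le_top)

end IsWiener

end Zak

/-! ### Summability over integer lattices -/

theorem summable_inv_one_add_abs_sq : Summable fun k : ℤ => ((1 + |(k : ℝ)|) ^ 2)⁻¹ := by
  have hnat : Summable fun k : ℕ => ((1 + |((k : ℤ) : ℝ)|) ^ 2)⁻¹ := by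
    refine ((summable_nat_add_iff 1).2 (Real.summable_one_div_nat_pow.2 one_lt_two)).congr
      fun k => ?_
    simp [abs_of_nonneg, add_comm]
  refine hnat.of_nat_of_neg (hnat.congr fun k => ?_)
  simp

theorem summable_pi_prod {ι κ : Type*} [Fintype ι] {f : κ → ℝ} (hf : Summable f)
    (hf₀ : ∀ k, 0 ≤ f k) : Summable fun p : ι → κ => ∏ i, f (p i) := by
  classical
  refine summable_of_sum_le (c := (∑' k, f k) ^ Fintype.card ι)
    (fun p => Finset.prod_nonneg fun i _ => hf₀ _) fun s => ?_
  calc ∑ p ∈ s, ∏ i, f (p i)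
      ≤ ∑ p ∈ Fintype.piFinset fun i => s.image fun p => p i, ∏ i, f (p i) :=
        Finset.sum_le_sum_of_subset_of_nonneg
          (fun p hp => Fintype.mem_piFinset.2 fun i => Finset.mem_image_of_mem _ hp)
          fun p _ _ => Finset.prod_nonneg fun i _ => hf₀ _
    _ = ∏ i, ∑ k ∈ s.image fun p => p i, f k := by rw [Finset.prod_univ_sum]
    _ ≤ ∏ _i : ι, ∑' k, f k :=
        Finset.prod_le_prod (fun i _ => Finset.sum_nonneg fun k _ => hf₀ k)
          fun i _ => hf.sum_le_tsum _ fun k _ => hf₀ k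
    _ = (∑' k, f k) ^ Fintype.card ι := by simp

theorem summable_inv_one_add_norm_pow (ι : Type*) [Fintype ι] :
    Summable fun p : ι → ℤ => ((1 + ‖intVec p‖) ^ (2 * Fintype.card ι))⁻¹ := by
  refine (summable_pi_prod (ι := ι) summable_inv_one_add_abs_sq
    fun k => by positivity).of_nonneg_of_le (fun p => by positivity) fun p => ?_
  rw [Finset.prod_inv_distrib]
  refine inv_anti₀ (Finset.prod_pos fun i _ => by positivity) ?_
  rw [Finset.prod_pow, mul_comm 2, pow_mul]
  refine pow_le_pow_left₀ (Finset.prod_nonneg fun i _ => by positivity) ?_ 2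
  calc ∏ i, (1 + |(p i : ℝ)|) ≤ ∏ _i : ι, (1 + ‖intVec p‖) :=
        Finset.prod_le_prod (fun i _ => by positivity) fun i _ =>
          add_le_add_right (norm_le_pi_norm (intVec p) i) 1
    _ = (1 + ‖intVec p‖) ^ Fintype.card ι := by simp

/-! ### Schwartz functions -/

section Schwartz

variable {ι : Type*} [Fintype ι]

theorem exists_one_add_norm_pow_mul_le (φ : 𝓢(ι → ℝ, ℂ)) (K : ℕ) :
    ∃ C, ∀ x, (1 + ‖x‖) ^ K * ‖φ x‖ ≤ C :=
  ⟨_, fun x => by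
    simpa using SchwartzMap.one_add_le_sup_seminorm_apply (𝕜 := ℂ) (m := (K, 0)) le_rfl le_rfl φ x⟩

theorem one_add_norm_le_of_mem_cube {σ : ℝ} (hσ : 0 < σ) (w p : ι → ℝ) {t : ι → ℝ}
    (ht : t ∈ cube ι 1) :
    1 + ‖p‖ ≤ (σ⁻¹ * (1 + ‖w‖) + 2) * (1 + ‖σ • (t + p) - w‖) := by
  set x := σ • (t + p) - w with hx
  have ht_norm : ‖t‖ ≤ 1 := (pi_norm_le_iff_of_nonneg zero_le_one).2 fun i => by
    rw [Real.norm_of_nonneg (ht i trivial).1]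
    exact (ht i trivial).2.le
  have hp : p = σ⁻¹ • (x + w) - t := by
    rw [hx, sub_add_cancel, smul_smul, inv_mul_cancel₀ hσ.ne', one_smul, add_sub_cancel_left]
  have hp_norm : ‖p‖ ≤ σ⁻¹ * (‖x‖ + ‖w‖) + 1 := by
    rw [hp]
    refine (norm_sub_le _ _).trans (add_le_add ?_ ht_norm)
    rw [norm_smul, Real.norm_of_nonneg (inv_nonneg.2 hσ.le)]
    exact mul_le_mul_of_nonneg_left (norm_add_le _ _) (inv_nonneg.2 hσ.le)
  have hcross : 0 ≤ σ⁻¹ * ‖w‖ * ‖x‖ := by positivity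
  have hσ_inv : 0 < σ⁻¹ := inv_pos.2 hσ
  linarith [norm_nonneg x]

theorem isWiener_schwartz_comp (φ : 𝓢(ι → ℝ, ℂ)) {σ : ℝ} (hσ : 0 < σ) (w : ι → ℝ) :
    IsWiener fun x => φ (σ • x - w) := by
  set K := 2 * Fintype.card ι
  obtain ⟨C, hC⟩ := exists_one_add_norm_pow_mul_le φ K
  have hφ := φ.continuous
  set M := σ⁻¹ * (1 + ‖w‖) + 2
  refine ⟨by fun_prop, fun p => C * M ^ K * ((1 + ‖intVec p‖) ^ K)⁻¹,
    (summable_inv_one_add_norm_pow ι).mul_left _, fun p t ht => ?_⟩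
  set x := σ • (t + intVec p) - w
  refine (le_div_iff₀ (by positivity)).2 ?_
  calc ‖φ x‖ * (1 + ‖intVec p‖) ^ K ≤ ‖φ x‖ * (M * (1 + ‖x‖)) ^ K := by
        gcongr
        exact one_add_norm_le_of_mem_cube hσ w _ ht
    _ = ((1 + ‖x‖) ^ K * ‖φ x‖) * M ^ K := by
        rw [mul_pow]
        ring
    _ ≤ C * M ^ K := mul_le_mul_of_nonneg_right (hC x) (by positivity)

/-! ### Rapid decay of ambiguity functions -/

theorem norm_phase_mul_comp_sub_le {ψ : (ι → ℝ) → ℂ} {M : ℝ} (hM : ∀ q, ‖ψ q‖ ≤ M)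
    (x z q : ι → ℝ) : ‖phase (z ⬝ᵥ q) * ψ (q - x)‖ ≤ M := by
  rw [norm_mul, norm_phase, one_mul]
  exact hM _

theorem exists_norm_schwartz_le (φ : 𝓢(ι → ℝ, ℂ)) : ∃ M, ∀ q, ‖φ q‖ ≤ M := by
  simpa using exists_one_add_norm_pow_mul_le φ 0

theorem integrable_ambiguity (φ ψ : 𝓢(ι → ℝ, ℂ)) (x z : ι → ℝ) :
    Integrable fun q => starRingEnd ℂ (φ q) * (phase (z ⬝ᵥ q) * ψ (q - x)) := by
  obtain ⟨M, hM⟩ := exists_norm_schwartz_le ψ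
  have hψ := ψ.continuous
  exact ((Complex.conjCLE : ℂ →L[ℝ] ℂ).integrable_comp φ.integrable).mul_bdd (c := M)
    (Continuous.aestronglyMeasurable (by fun_prop))
    (Filter.Eventually.of_forall (norm_phase_mul_comp_sub_le hM x z))

theorem exists_norm_ambiguity_le (φ ψ : 𝓢(ι → ℝ, ℂ)) : ∃ C, ∀ x z, ‖ambiguity φ ψ x z‖ ≤ C := by
  obtain ⟨M, hM⟩ := exists_norm_schwartz_le ψ
  refine ⟨∫ q, ‖φ q‖ * M, fun x z => norm_integral_le_of_norm_le (φ.integrable.norm.mul_const M)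
    (Filter.Eventually.of_forall fun q => ?_)⟩
  rw [norm_mul, RCLike.norm_conj]
  exact mul_le_mul_of_nonneg_left (norm_phase_mul_comp_sub_le hM x z q) (norm_nonneg _)

/-- Multiplication of a Schwartz function by the coordinate `q k`: the position operator of the
`k`-th mode, up to scaling. -/
def coordMul (k : ι) (φ : 𝓢(ι → ℝ, ℂ)) : 𝓢(ι → ℝ, ℂ) :=
  SchwartzMap.smulLeftCLM ℂ (ContinuousLinearMap.proj (R := ℝ) (φ := fun _ : ι => ℝ) k) φ

theorem coordMul_apply (k : ι) (φ : 𝓢(ι → ℝ, ℂ)) (q : ι → ℝ) :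
    coordMul k φ q = (q k : ℂ) * φ q := by
  rw [coordMul, SchwartzMap.smulLeftCLM_apply_apply (by fun_prop)]
  simp

theorem ambiguity_coordMul (k : ι) (φ ψ : 𝓢(ι → ℝ, ℂ)) (x z : ι → ℝ) :
    (x k : ℂ) * ambiguity φ ψ x z =
      ambiguity (coordMul k φ) ψ x z - ambiguity φ (coordMul k ψ) x z := by
  rw [ambiguity, ambiguity, ambiguity,
    ← integral_sub (integrable_ambiguity _ _ x z) (integrable_ambiguity _ _ x z),
    ← integral_const_mul]
  refine integral_congr_ae (Filter.Eventually.of_forall fun q => ?_)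
  simp only [coordMul_apply, map_mul, Complex.conj_ofReal, Pi.sub_apply]
  push_cast
  ring

section LineDeriv

variable [DecidableEq ι]

/-- The partial derivative of a Schwartz function in the direction of the coordinate `q k`: the
momentum operator of the `k`-th mode, up to scaling. -/
def partialDeriv (k : ι) (φ : 𝓢(ι → ℝ, ℂ)) : 𝓢(ι → ℝ, ℂ) :=
  LineDeriv.lineDerivOp (Pi.single k (1 : ℝ) : ι → ℝ) φ

theorem hasLineDerivAt_partialDeriv (k : ι) (φ : 𝓢(ι → ℝ, ℂ)) (q : ι → ℝ) :
    HasLineDerivAt ℝ φ (partialDeriv k φ q) q (Pi.single k 1) :=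
  (φ.hasFDerivAt q).hasLineDerivAt _

theorem hasLineDerivAt_conj (k : ι) (φ : 𝓢(ι → ℝ, ℂ)) (q : ι → ℝ) :
    HasLineDerivAt ℝ (fun q => starRingEnd ℂ (φ q)) (starRingEnd ℂ (partialDeriv k φ q)) q
      (Pi.single k 1) :=
  (Complex.conjCLE : ℂ →L[ℝ] ℂ).hasFDerivAt.comp_hasDerivAt _ (hasLineDerivAt_partialDeriv k φ q)

theorem hasLineDerivAt_comp_sub (k : ι) (ψ : 𝓢(ι → ℝ, ℂ)) (x q : ι → ℝ) :
    HasLineDerivAt ℝ (fun q => ψ (q - x)) (partialDeriv k ψ (q - x)) q (Pi.single k 1) := by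
  have hψ := hasLineDerivAt_partialDeriv k ψ (q - x)
  rw [HasLineDerivAt] at hψ ⊢
  convert! hψ using 3
  abel

theorem hasLineDerivAt_phase_dotProduct (k : ι) (z q : ι → ℝ) :
    HasLineDerivAt ℝ (fun q => phase (z ⬝ᵥ q)) (Complex.I * (z k : ℂ) * phase (z ⬝ᵥ q)) q
      (Pi.single k 1) := by
  have hlinear : HasDerivAt (fun t : ℝ => z ⬝ᵥ (q + t • (Pi.single k 1 : ι → ℝ))) (z k) 0 := by
    simp only [dotProduct_add, dotProduct_smul, dotProduct_single_one, smul_eq_mul]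
    simpa using ((hasDerivAt_id (0 : ℝ)).mul_const (z k)).const_add (z ⬝ᵥ q)
  have hexp := (hlinear.ofReal_comp.const_mul Complex.I).cexp
  rw [zero_smul, add_zero] at hexp
  rw [mul_comm _ (phase _)]
  exact hexp

theorem hasLineDerivAt_phase_mul_comp_sub (k : ι) (ψ : 𝓢(ι → ℝ, ℂ)) (x z q : ι → ℝ) :
    HasLineDerivAt ℝ (fun q => phase (z ⬝ᵥ q) * ψ (q - x))
      (Complex.I * (z k : ℂ) * phase (z ⬝ᵥ q) * ψ (q - x) +
        phase (z ⬝ᵥ q) * partialDeriv k ψ (q - x)) q (Pi.single k 1) := by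
  have hmul := (hasLineDerivAt_phase_dotProduct k z q).mul (hasLineDerivAt_comp_sub k ψ x q)
  simp only [zero_smul, add_zero] at hmul
  exact hmul

theorem ambiguity_partialDeriv (k : ι) (φ ψ : 𝓢(ι → ℝ, ℂ)) (x z : ι → ℝ) :
    Complex.I * (z k : ℂ) * ambiguity φ ψ x z =
      -ambiguity (partialDeriv k φ) ψ x z - ambiguity φ (partialDeriv k ψ) x z := by
  have hint := (integrable_ambiguity φ ψ x z).const_mul (Complex.I * (z k : ℂ))
  have hint' := integrable_ambiguity φ (partialDeriv k ψ) x z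
  have hsplit : ∀ q, starRingEnd ℂ (φ q) *
      (Complex.I * (z k : ℂ) * phase (z ⬝ᵥ q) * ψ (q - x) +
        phase (z ⬝ᵥ q) * partialDeriv k ψ (q - x)) =
      Complex.I * (z k : ℂ) * (starRingEnd ℂ (φ q) * (phase (z ⬝ᵥ q) * ψ (q - x))) +
      starRingEnd ℂ (φ q) * (phase (z ⬝ᵥ q) * partialDeriv k ψ (q - x)) := fun q => by ring
  have hparts := integral_bilinear_hasLineDerivAt_right_eq_neg_left_of_integrable
    (B := ContinuousLinearMap.mul ℝ ℂ) (integrable_ambiguity (partialDeriv k φ) ψ x z)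
    ((hint.add hint').congr (Filter.Eventually.of_forall fun q => (hsplit q).symm))
    (integrable_ambiguity φ ψ x z) (fun q _ => hasLineDerivAt_conj k φ q)
    fun q _ => hasLineDerivAt_phase_mul_comp_sub k ψ x z q
  simp only [ContinuousLinearMap.mul_apply', hsplit] at hparts
  rw [integral_add hint hint', integral_const_mul] at hparts
  rw [ambiguity, ambiguity, ambiguity, eq_sub_iff_add_eq]
  exact hparts

end LineDeriv

/-- The weight `1 + ∑ |x_k| + ∑ |z_k|` on phase space, in which the decay of ambiguity functions is
measured. -/
def weight (x z : ι → ℝ) : ℝ := 1 + ∑ k, |x k| + ∑ k, |z k|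

theorem weight_nonneg (x z : ι → ℝ) : 0 ≤ weight x z := by
  unfold weight
  positivity

theorem norm_le_sum_abs (x : ι → ℝ) : ‖x‖ ≤ ∑ k, |x k| :=
  (pi_norm_le_iff_of_nonneg (Finset.sum_nonneg fun _ _ => abs_nonneg _)).2 fun k =>
    Finset.single_le_sum (f := fun k => |x k|) (fun _ _ => abs_nonneg _) (Finset.mem_univ k)

theorem one_add_norm_left_le_weight (x z : ι → ℝ) : 1 + ‖x‖ ≤ weight x z :=
  le_add_of_le_of_nonneg (add_le_add_right (norm_le_sum_abs x) 1)
    (Finset.sum_nonneg fun _ _ => abs_nonneg _)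

theorem one_add_norm_right_le_weight (x z : ι → ℝ) : 1 + ‖z‖ ≤ weight x z :=
  add_le_add (le_add_of_nonneg_right (Finset.sum_nonneg fun _ _ => abs_nonneg _))
    (norm_le_sum_abs z)

theorem exists_weight_pow_mul_ambiguity_le (K : ℕ) (φ ψ : 𝓢(ι → ℝ, ℂ)) :
    ∃ C, ∀ x z, weight x z ^ K * ‖ambiguity φ ψ x z‖ ≤ C := by
  classical
  induction K generalizing φ ψ with
  | zero => simpa using exists_norm_ambiguity_le φ ψ
  | succ K ih =>
    choose C hC using ih
    refine ⟨C φ ψ + ∑ k, (C (coordMul k φ) ψ + C φ (coordMul k ψ)) +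
      ∑ k, (C (partialDeriv k φ) ψ + C φ (partialDeriv k ψ)), fun x z => ?_⟩
    have hweight : 0 ≤ weight x z ^ K := pow_nonneg (weight_nonneg x z) K
    have hx : ∀ k, weight x z ^ K * (|x k| * ‖ambiguity φ ψ x z‖) ≤
        C (coordMul k φ) ψ + C φ (coordMul k ψ) := fun k => by
      refine (mul_le_mul_of_nonneg_left ?_ hweight).trans
        ((mul_add _ _ _).trans_le (add_le_add (hC _ _ x z) (hC _ _ x z)))
      rw [← Real.norm_eq_abs, ← Complex.norm_real, ← norm_mul, ambiguity_coordMul]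
      exact norm_sub_le _ _
    have hz : ∀ k, weight x z ^ K * (|z k| * ‖ambiguity φ ψ x z‖) ≤
        C (partialDeriv k φ) ψ + C φ (partialDeriv k ψ) := fun k => by
      refine (mul_le_mul_of_nonneg_left ?_ hweight).trans
        ((mul_add _ _ _).trans_le (add_le_add (hC _ _ x z) (hC _ _ x z)))
      rw [← Real.norm_eq_abs, ← Complex.norm_real, ← one_mul ‖(z k : ℂ)‖, ← Complex.norm_I,
        ← norm_mul, ← norm_mul, ambiguity_partialDeriv]
      exact (norm_sub_le _ _).trans_eq (by rw [norm_neg])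
    calc weight x z ^ (K + 1) * ‖ambiguity φ ψ x z‖
        = weight x z ^ K * ‖ambiguity φ ψ x z‖ +
            ∑ k, weight x z ^ K * (|x k| * ‖ambiguity φ ψ x z‖) +
            ∑ k, weight x z ^ K * (|z k| * ‖ambiguity φ ψ x z‖) := by
          rw [← Finset.mul_sum, ← Finset.mul_sum, ← Finset.sum_mul, ← Finset.sum_mul, pow_succ]
          nth_rewrite 2 [weight]
          ring
      _ ≤ _ := add_le_add (add_le_add (hC _ _ x z) (Finset.sum_le_sum fun k _ => hx k))
          (Finset.sum_le_sum fun k _ => hz k)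

theorem summable_norm_ambiguity (φ ψ : 𝓢(ι → ℝ, ℂ)) {σ : ℝ} (hσ : 0 < σ) :
    Summable fun a : (ι → ℤ) × (ι → ℤ) =>
      ‖ambiguity φ ψ (σ • intVec a.1) (σ • intVec a.2)‖ := by
  set K := 2 * Fintype.card ι
  obtain ⟨C, hC⟩ := exists_weight_pow_mul_ambiguity_le (K + K) φ ψ
  obtain ⟨M, hM₀, hM⟩ : ∃ M : ℝ, 0 < M ∧ ∀ p : ι → ℝ, 1 + ‖p‖ ≤ M * (1 + ‖σ • p‖) :=
    ⟨σ⁻¹ + 2, by positivity, fun p => by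
      simpa using one_add_norm_le_of_mem_cube hσ 0 p (t := 0) fun _ _ => by simp⟩
  have hsum := ((summable_inv_one_add_norm_pow ι).mul_of_nonneg (summable_inv_one_add_norm_pow ι)
    (fun p => by positivity) fun p => by positivity).mul_left (M ^ (K + K) * C)
  refine hsum.of_nonneg_of_le (fun _ => norm_nonneg _) fun a => ?_
  set x := σ • intVec a.1
  set z := σ • intVec a.2
  have hweight := weight_nonneg x z
  have hx : 1 + ‖intVec a.1‖ ≤ M * weight x z := (hM _).trans
    (mul_le_mul_of_nonneg_left (one_add_norm_left_le_weight x z) hM₀.le)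
  have hz : 1 + ‖intVec a.2‖ ≤ M * weight x z := (hM _).trans
    (mul_le_mul_of_nonneg_left (one_add_norm_right_le_weight x z) hM₀.le)
  rw [← mul_inv]
  refine (le_div_iff₀ (by positivity)).2 ?_
  calc ‖ambiguity φ ψ x z‖ * ((1 + ‖intVec a.1‖) ^ K * (1 + ‖intVec a.2‖) ^ K)
      ≤ ‖ambiguity φ ψ x z‖ * ((M * weight x z) ^ K * (M * weight x z) ^ K) := by gcongr
    _ = M ^ (K + K) * (weight x z ^ (K + K) * ‖ambiguity φ ψ x z‖) := by
        rw [← pow_add, mul_pow]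
        ring
    _ ≤ M ^ (K + K) * C := mul_le_mul_of_nonneg_left (hC x z) (by positivity)

end Schwartz

section DisplacementMatrixElements

variable {n : ℕ}

theorem inner_disp_toLp (d : ℕ) (φ ψ : 𝓢(Fin n → ℝ, ℂ)) (a : Phase n) :
    ⟪φ.toLp 2 volume, disp d a (ψ.toLp 2 volume)⟫_ℂ =
      phase (-(Real.pi * (a.1 ⬝ᵥ a.2) / d)) * ambiguity φ ψ (ell d • a.1) (ell d • a.2) := by
  rw [L2.inner_def, ambiguity, ← integral_const_mul]
  refine integral_congr_ae ?_
  filter_upwards [φ.coeFn_toLp 2 volume, coeFn_disp d a (ψ.toLp 2 volume),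
    dispFun_congr d a (ψ.coeFn_toLp 2 volume)] with q hφ hdisp hψ
  rw [hφ, hdisp, hψ, dispFun_eq, RCLike.inner_apply, sub_eq_add_neg, phase_add, smul_dotProduct,
    smul_eq_mul]
  ring

theorem summable_norm_inner_disp {d : ℕ} (hd : 0 < d) (φ ψ : 𝓢(Fin n → ℝ, ℂ)) :
    Summable fun a : Lattice n => ‖⟪φ.toLp 2 volume, disp d a.toPhase (ψ.toLp 2 volume)⟫_ℂ‖ := by
  refine (summable_norm_ambiguity φ ψ (ell_pos hd)).congr fun a => ?_
  rw [inner_disp_toLp, norm_mul, norm_phase, one_mul]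
  rfl

end DisplacementMatrixElements

/-! ### Averages over residues -/

section Residues

variable {ι : Type*} {d : ℕ}

/-- The point `((j + t) / d, v)` of the unit box, for a point `(t, v)` of the unit box: the GKP
form at the syndrome `(t, v)` is a sum over these points. -/
def subcellPoint (j : ι → Fin d) (x : (ι → ℝ) × (ι → ℝ)) : (ι → ℝ) × (ι → ℝ) :=
  ((d : ℝ)⁻¹ • (intVec (residueVec j) + x.1), x.2)

/-- The displacement `(r / d, 0)` between the points `subcellPoint j x`. -/
def residueShift (r : ι → Fin d) : (ι → ℝ) × (ι → ℝ) := ((d : ℝ)⁻¹ • intVec (residueVec r), 0)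

theorem continuous_subcellPoint (j : ι → Fin d) : Continuous (subcellPoint j) := by
  unfold subcellPoint
  fun_prop

theorem mapsTo_subcellPoint (hd : 0 < d) (j : ι → Fin d) :
    Set.MapsTo (subcellPoint j) (unitBox ι) (unitBox ι) := fun x hx => by
  have hd₀ : (0 : ℝ) < d := Nat.cast_pos.2 hd
  have hmem := Set.mem_iUnion_of_mem (s := fun j : ι → Fin d => cell (d : ℝ)⁻¹ (residueVec j)) j
    ((smul_intVec_add_mem_cell_iff (inv_pos.2 hd₀) (residueVec j) x.1).2 hx.1)
  rw [iUnion_cell_residueVec (inv_pos.2 hd₀), mul_inv_cancel₀ hd₀.ne'] at hmem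
  exact ⟨hmem, hx.2⟩

theorem subcellPoint_sub [NeZero d] (j r : ι → Fin d) (x : (ι → ℝ) × (ι → ℝ)) :
    subcellPoint (j - r) x =
      subcellPoint j x - residueShift r + (intVec fun k => if r k ≤ j k then 0 else 1, 0) := by
  have hd : (d : ℝ) ≠ 0 := NeZero.ne _
  refine Prod.ext (funext fun k => ?_) (by simp [subcellPoint, residueShift])
  have hval : (((j k - r k : Fin d) : ℕ) : ℝ) =
      ((j k : ℕ) : ℝ) - ((r k : ℕ) : ℝ) + if r k ≤ j k then 0 else (d : ℝ) := by
    exact_mod_cast Fin.intCast_val_sub_eq_sub_add_ite (j k) (r k)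
  simp only [subcellPoint, residueShift, intVec, residueVec, Prod.fst_add, Prod.fst_sub,
    Pi.add_apply, Pi.sub_apply, Pi.smul_apply, smul_eq_mul, Int.cast_natCast, hval]
  split_ifs
  · simp only [Int.cast_zero]
    ring
  · simp only [Int.cast_one]
    field_simp
    ring

variable [Fintype ι] [DecidableEq ι]

theorem sum_subcellPoint_sub_residueShift {M : Type*} [AddCommMonoid M] [NeZero d]
    {f : (ι → ℝ) × (ι → ℝ) → M} (hf : ∀ x e, f (x + (intVec e, 0)) = f x) (j : ι → Fin d)
    (x : (ι → ℝ) × (ι → ℝ)) :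
    ∑ r : ι → Fin d, f (subcellPoint j x - residueShift r) =
      ∑ k : ι → Fin d, f (subcellPoint k x) := by
  rw [← (Equiv.subLeft j).sum_comp fun k => f (subcellPoint k x)]
  refine Finset.sum_congr rfl fun r _ => ?_
  rw [Equiv.subLeft_apply, subcellPoint_sub, hf]

theorem setIntegral_unitBox_eq_sum_subcellPoint (hd : 0 < d) {f : (ι → ℝ) × (ι → ℝ) → ℂ}
    (hf : IntegrableOn f (unitBox ι))
    (hf_sub : ∀ j : ι → Fin d, IntegrableOn (fun x => f (subcellPoint j x)) (unitBox ι)) :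
    ∫ x in unitBox ι, f x = ((((d : ℝ) ^ Fintype.card ι)⁻¹ : ℝ) : ℂ) *
      ∑ j : ι → Fin d, ∫ x in unitBox ι, f (subcellPoint j x) := by
  have hd₀ : (0 : ℝ) < d := Nat.cast_pos.2 hd
  rw [unitBox, Measure.volume_eq_prod] at hf hf_sub ⊢
  have hinner : IntegrableOn (fun t => ∫ v in cube ι 1, f (t, v)) (cube ι (d * (d : ℝ)⁻¹)) := by
    rw [IntegrableOn, ← Measure.prod_restrict] at hf
    rw [mul_inv_cancel₀ hd₀.ne']
    exact hf.integral_prod_left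
  have hcells := sum_setIntegral_cell (inv_pos.2 hd₀) hinner
  rw [mul_inv_cancel₀ hd₀.ne'] at hcells
  rw [setIntegral_prod _ hf, ← hcells, Finset.mul_sum]
  refine Finset.sum_congr rfl fun j _ => ?_
  rw [setIntegral_cell (inv_pos.2 hd₀), setIntegral_prod _ (hf_sub j), inv_pow]
  rfl

theorem sum_setIntegral_mul_sub_residueShift (hd : 0 < d) {f g : (ι → ℝ) × (ι → ℝ) → ℂ}
    (hg : ∀ x e, g (x + (intVec e, 0)) = g x)
    (hfg : ∀ r : ι → Fin d, IntegrableOn (fun x => f x * g (x - residueShift r)) (unitBox ι))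
    (hfg_sub : ∀ j r : ι → Fin d, IntegrableOn
      (fun x => f (subcellPoint j x) * g (subcellPoint j x - residueShift r)) (unitBox ι)) :
    ∑ r : ι → Fin d, ∫ x in unitBox ι, f x * g (x - residueShift r) =
      ((((d : ℝ) ^ Fintype.card ι)⁻¹ : ℝ) : ℂ) * ∫ x in unitBox ι,
        (∑ j : ι → Fin d, f (subcellPoint j x)) * ∑ k : ι → Fin d, g (subcellPoint k x) := by
  have : NeZero d := ⟨hd.ne'⟩
  have hsum : ∀ x, (∑ j : ι → Fin d, f (subcellPoint j x)) * ∑ k : ι → Fin d, g (subcellPoint k x) =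
      ∑ r : ι → Fin d, ∑ j : ι → Fin d,
        f (subcellPoint j x) * g (subcellPoint j x - residueShift r) := fun x => by
    rw [Finset.sum_comm, Finset.sum_mul]
    refine Finset.sum_congr rfl fun j _ => ?_
    rw [← Finset.mul_sum, sum_subcellPoint_sub_residueShift hg]
  simp only [hsum]
  rw [integral_finsetSum _ fun r _ => integrable_finsetSum _ fun j _ => hfg_sub j r,
    Finset.mul_sum]
  refine Finset.sum_congr rfl fun r _ => ?_
  rw [integral_finsetSum _ fun j _ => hfg_sub j r]
  exact setIntegral_unitBox_eq_sum_subcellPoint hd (hfg r) fun j => hfg_sub j r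

end Residues

/-! ### GKP forms as sums of Zak transforms -/

section ZakPeriodicity

variable {ι : Type*} [Fintype ι]

theorem zak_comp_sub (A : (ι → ℝ) → ℂ) (w : ι → ℝ) (x : (ι → ℝ) × (ι → ℝ)) :
    zak (fun y => A (y - w)) x = zak A (x - (w, 0)) := by
  simp only [zak, zakTerm, Prod.fst_sub, Prod.snd_sub, sub_zero, add_sub_right_comm]

theorem zakProd_comp_sub (A B : (ι → ℝ) → ℂ) (w : ι → ℝ) (x : (ι → ℝ) × (ι → ℝ)) :
    zakProd (fun y => A (y - w)) (fun y => B (y - w)) x = zakProd A B (x - (w, 0)) := by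
  rw [zakProd, zakProd, zak_comp_sub, zak_comp_sub]

theorem zak_add_intVec (A : (ι → ℝ) → ℂ) (x : (ι → ℝ) × (ι → ℝ)) (e : ι → ℤ) :
    zak A (x + (intVec e, 0)) = phase (2 * Real.pi * (x.2 ⬝ᵥ intVec e)) * zak A x := by
  rw [zak, zak, ← tsum_mul_left, ← (Equiv.addRight e).tsum_eq fun p =>
    phase (2 * Real.pi * (x.2 ⬝ᵥ intVec e)) * zakTerm A p x]
  refine tsum_congr fun p => ?_
  rw [Equiv.coe_addRight, zakTerm, zakTerm, ← mul_assoc, ← phase_add, intVec_add, dotProduct_add,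
    Prod.fst_add, Prod.snd_add, add_zero, add_assoc, add_comm (intVec e)]
  congr 2
  ring

theorem zakProd_add_intVec (A B : (ι → ℝ) → ℂ) (x : (ι → ℝ) × (ι → ℝ)) (e : ι → ℤ) :
    zakProd A B (x + (intVec e, 0)) = zakProd A B x := by
  rw [zakProd, zakProd, zak_add_intVec, zak_add_intVec, map_mul, mul_mul_mul_comm, conj_phase,
    ← phase_add, neg_add_cancel, phase_zero, one_mul]

/-- The function `φ` in the unit of length `σ`. -/
def dilate (σ : ℝ) (φ : (ι → ℝ) → ℂ) (x : ι → ℝ) : ℂ := φ (σ • x)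

theorem isWiener_dilate_comp_sub (φ : 𝓢(ι → ℝ, ℂ)) {σ : ℝ} (hσ : 0 < σ) (w : ι → ℝ) :
    IsWiener fun y => dilate σ φ (y - w) := by
  simpa only [dilate, smul_sub] using isWiener_schwartz_comp φ hσ (σ • w)

theorem isWiener_dilate (φ : 𝓢(ι → ℝ, ℂ)) {σ : ℝ} (hσ : 0 < σ) : IsWiener (dilate σ φ) := by
  simpa only [sub_zero] using isWiener_dilate_comp_sub φ hσ 0

/-- The product `conj (Z f) * Z g` in the unit of length `d ℓ`, the period of the GKP states: its
sums over the points `subcellPoint j s` are the GKP forms. -/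
def gkpDensity (d : ℕ) (f g : (ι → ℝ) → ℂ) : (ι → ℝ) × (ι → ℝ) → ℂ :=
  zakProd (dilate (d * ell d) f) (dilate (d * ell d) g)

end ZakPeriodicity

section GKP

variable {n d : ℕ}

theorem gkpBra_dispFun_neg (hd : 0 < d) (j : Fin n → Fin d) (s : Phase n)
    (f : (Fin n → ℝ) → ℂ) :
    gkpBra d j (dispFun d (-s) f) =
      phase (-(2 * Real.pi / d * (s.2 ⬝ᵥ intVec (residueVec j))) -
          Real.pi * (s.1 ⬝ᵥ s.2) / d) *
        ((((Real.sqrt (ell d))⁻¹ ^ n : ℝ) : ℂ) *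
          zak (dilate (d * ell d) f) (subcellPoint j s)) := by
  have hd₀ : (d : ℝ) ≠ 0 := Nat.cast_ne_zero.2 hd.ne'
  rw [gkpBra, zak, mul_left_comm, ← tsum_mul_left (a := phase _)]
  congr 1
  refine tsum_congr fun m => ?_
  have hcomb : (fun k => ell d * ((d : ℝ) * (m k : ℝ) + ((j k : ℕ) : ℝ))) =
      ell d • ((d : ℝ) • intVec m + intVec (residueVec j)) := by
    ext k
    simp [intVec, residueVec]
  rw [hcomb, dispFun_eq, zakTerm, ← mul_assoc, ← phase_add, dilate, subcellPoint]
  congr 2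
  · simp only [Prod.fst_neg, Prod.snd_neg, neg_dotProduct, dotProduct_neg, dotProduct_smul,
      dotProduct_add, smul_eq_mul, mul_neg, neg_neg]
    rw [← mul_assoc, ell_mul_ell]
    field_simp
    ring
  · rw [Prod.fst_neg, smul_neg, sub_neg_eq_add, smul_add, smul_add, smul_smul (d * ell d),
      mul_right_comm, mul_inv_cancel₀ hd₀, one_mul, smul_add, smul_smul (ell d),
      mul_comm (ell d) (d : ℝ)]
    abel

theorem gkpForm_eq (hd : 0 < d) (s : Phase n) (f g : (Fin n → ℝ) → ℂ) :
    gkpForm d s f g = (((ell d)⁻¹ ^ n : ℝ) : ℂ) *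
      ∑ j : Fin n → Fin d, gkpDensity d f g (subcellPoint j s) := by
  rw [gkpForm, Finset.mul_sum]
  refine Finset.sum_congr rfl fun j _ => ?_
  rw [gkpBra_dispFun_neg hd, gkpBra_dispFun_neg hd, map_mul, mul_mul_mul_comm, conj_phase,
    ← phase_add, neg_add_cancel, phase_zero, one_mul, map_mul, mul_mul_mul_comm,
    Complex.conj_ofReal, ← Complex.ofReal_mul, ← mul_pow, ← mul_inv,
    Real.mul_self_sqrt (ell_pos hd).le, gkpDensity, zakProd]

theorem integrableOn_unitBox_mul {ι : Type*} [Fintype ι] {f g : (ι → ℝ) × (ι → ℝ) → ℂ}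
    (hf : MemLp f ⊤ (volume.restrict (unitBox ι))) (hg : MemLp g ⊤ (volume.restrict (unitBox ι))) :
    IntegrableOn (fun x => f x * g x) (unitBox ι) :=
  (MemLp.mul (p := ⊤) (q := ⊤) (r := ⊤) hg hf).integrable le_top

theorem memLp_gkpDensity_sub {ι : Type*} [Fintype ι] (hd : 0 < d) (φ ψ : 𝓢(ι → ℝ, ℂ)) (w : ι → ℝ)
    {τ : (ι → ℝ) × (ι → ℝ) → (ι → ℝ) × (ι → ℝ)} (hτ : Continuous τ)
    (hmaps : Set.MapsTo τ (unitBox ι) (unitBox ι)) :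
    MemLp (fun x => gkpDensity d φ ψ (τ x - (w, 0))) ⊤ (volume.restrict (unitBox ι)) := by
  have hσ : 0 < d * ell d := mul_pos (Nat.cast_pos.2 hd) (ell_pos hd)
  simp only [gkpDensity, ← zakProd_comp_sub]
  exact (isWiener_dilate_comp_sub φ hσ w).memLp_zakProd_comp (isWiener_dilate_comp_sub ψ hσ w)
    hτ.continuousOn hmaps

theorem memLp_gkpDensity_comp {ι : Type*} [Fintype ι] (hd : 0 < d) (φ ψ : 𝓢(ι → ℝ, ℂ))
    {τ : (ι → ℝ) × (ι → ℝ) → (ι → ℝ) × (ι → ℝ)} (hτ : Continuous τ)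
    (hmaps : Set.MapsTo τ (unitBox ι) (unitBox ι)) :
    MemLp (fun x => gkpDensity d φ ψ (τ x)) ⊤ (volume.restrict (unitBox ι)) := by
  simpa only [Prod.mk_zero_zero, sub_zero] using memLp_gkpDensity_sub hd φ ψ 0 hτ hmaps

theorem integrable_gkpForm_mul (hd : 0 < d) (φ α β ψ : 𝓢(Fin n → ℝ, ℂ)) :
    Integrable (fun s => gkpForm d s φ α * gkpForm d s β ψ) (cellMeasure n d) := by
  have hbounded : ∀ f g : 𝓢(Fin n → ℝ, ℂ),
      MemLp (fun s => gkpForm d s f g) ⊤ (volume.restrict (unitBox (Fin n))) := fun f g => by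
    simp only [gkpForm_eq hd]
    exact (memLp_finsetSum Finset.univ fun j _ => memLp_gkpDensity_comp hd f g
      (continuous_subcellPoint j) (mapsTo_subcellPoint hd j)).const_mul _
  exact (integrableOn_unitBox_mul (hbounded φ α) (hbounded β ψ)).smul_measure
    ENNReal.ofReal_ne_top

theorem sum_setIntegral_gkpDensity_mul (hd : 0 < d) (φ α β ψ : 𝓢(Fin n → ℝ, ℂ)) :
    ∑ r : Fin n → Fin d, ∫ x in unitBox (Fin n),
        gkpDensity d φ α x * gkpDensity d β ψ (x - residueShift r) =
      ((((d : ℝ) ^ n)⁻¹ * ell d ^ (2 * n) : ℝ) : ℂ) *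
        ∫ s in unitBox (Fin n), gkpForm d s φ α * gkpForm d s β ψ := by
  have hl : ell d ≠ 0 := (ell_pos hd).ne'
  have hform : ∀ s, gkpForm d s φ α * gkpForm d s β ψ = (((ell d ^ (2 * n))⁻¹ : ℝ) : ℂ) *
      ((∑ j : Fin n → Fin d, gkpDensity d φ α (subcellPoint j s)) *
        ∑ k : Fin n → Fin d, gkpDensity d β ψ (subcellPoint k s)) := fun s => by
    rw [gkpForm_eq hd, gkpForm_eq hd, mul_mul_mul_comm, ← Complex.ofReal_mul, ← pow_add, ← two_mul,
      inv_pow]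
  simp only [hform]
  rw [integral_const_mul, ← mul_assoc, ← Complex.ofReal_mul, mul_assoc,
    mul_inv_cancel₀ (pow_ne_zero _ hl), mul_one, sum_setIntegral_mul_sub_residueShift hd,
    Fintype.card_fin]
  · exact fun x e => zakProd_add_intVec _ _ x e
  · exact fun r => integrableOn_unitBox_mul
      (memLp_gkpDensity_comp hd φ α continuous_id (Set.mapsTo_id _))
      (memLp_gkpDensity_sub hd β ψ _ continuous_id (Set.mapsTo_id _))
  · exact fun j r => integrableOn_unitBox_mul
      (memLp_gkpDensity_comp hd φ α (continuous_subcellPoint j) (mapsTo_subcellPoint hd j))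
      (memLp_gkpDensity_sub hd β ψ _ (continuous_subcellPoint j) (mapsTo_subcellPoint hd j))

end GKP

/-! ### Matrix elements of displacements and GKP forms -/

section Parseval

variable {ι : Type*}

/-- The bijection `(r, a) ↦ (r - d a_Z, a_X)` between pairs of a vector of residues and a lattice
vector, and lattice vectors. -/
def latticeSplit (ι : Type*) (d : ℕ) [NeZero d] :
    (ι → Fin d) × ((ι → ℤ) × (ι → ℤ)) ≃ (ι → ℤ) × (ι → ℤ) where
  toFun p := (fun k => (Int.divModEquiv d).symm (-p.2.2 k, p.1 k), p.2.1)
  invFun b := (fun k => (Int.divModEquiv d (b.1 k)).2,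
    (b.2, fun k => -(Int.divModEquiv d (b.1 k)).1))
  left_inv p := by simp only [Equiv.apply_symm_apply, neg_neg, Prod.mk.eta]
  right_inv b := by simp only [neg_neg, Prod.mk.eta, Equiv.symm_apply_apply]

variable [Fintype ι] {d : ℕ}

theorem ambiguity_dilate {σ : ℝ} (hσ : 0 < σ) (φ ψ : (ι → ℝ) → ℂ) (w x z : ι → ℝ) :
    ambiguity φ ψ (σ • (w + x)) z = ((σ ^ Fintype.card ι : ℝ) : ℂ) *
      ambiguity (dilate σ φ) (fun y => dilate σ ψ (y - w)) x (σ • z) := by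
  have hscale := Measure.integral_comp_smul (volume : Measure (ι → ℝ))
    (fun q => starRingEnd ℂ (φ q) * (phase (z ⬝ᵥ q) * ψ (q - σ • (w + x)))) σ
  rw [Module.finrank_fintype_fun_eq_card, abs_of_nonneg (by positivity)] at hscale
  have hdilate : ∀ q, starRingEnd ℂ (dilate σ φ q) *
        (phase (σ • z ⬝ᵥ q) * dilate σ ψ (q - x - w)) =
      starRingEnd ℂ (φ (σ • q)) *
        (phase (z ⬝ᵥ σ • q) * ψ (σ • q - σ • (w + x))) := fun q => by
    rw [dilate, dilate, smul_dotProduct, dotProduct_smul, ← smul_sub, sub_sub, add_comm x]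
  rw [ambiguity, ambiguity]
  simp only [hdilate]
  rw [hscale, Complex.real_smul, ← mul_assoc, ← Complex.ofReal_mul,
    mul_inv_cancel₀ (pow_pos hσ _).ne', Complex.ofReal_one, one_mul]

theorem ambiguity_latticeSplit [NeZero d] (φ ψ : (ι → ℝ) → ℂ) (r : ι → Fin d)
    (a : (ι → ℤ) × (ι → ℤ)) :
    ambiguity φ ψ (ell d • intVec (latticeSplit ι d (r, a)).1)
        (ell d • intVec (latticeSplit ι d (r, a)).2) =
      (((d * ell d) ^ Fintype.card ι : ℝ) : ℂ) * ambiguity (dilate (d * ell d) φ)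
        (fun y => dilate (d * ell d) ψ (y - (d : ℝ)⁻¹ • intVec (residueVec r)))
        (-intVec a.2) ((2 * Real.pi) • intVec a.1) := by
  have hd : 0 < d := Nat.pos_of_neZero d
  have hd₀ : (d : ℝ) ≠ 0 := NeZero.ne _
  have hposition : ell d • intVec (latticeSplit ι d (r, a)).1 =
      (d * ell d) • ((d : ℝ)⁻¹ • intVec (residueVec r) + -intVec a.2) := by
    ext k
    simp only [latticeSplit, Equiv.coe_fn_mk, Int.divModEquiv_symm_apply, intVec, residueVec,
      Pi.smul_apply, Pi.add_apply, Pi.neg_apply, smul_eq_mul]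
    push_cast
    field_simp
    ring
  have hmomentum : (2 * Real.pi) • intVec a.1 =
      (d * ell d) • ell d • intVec (latticeSplit ι d (r, a)).2 := by
    rw [smul_smul, mul_comm (d * ell d), ell_mul_period hd]
    rfl
  rw [hposition, hmomentum, ambiguity_dilate (mul_pos (Nat.cast_pos.2 hd) (ell_pos hd))]

theorem hasSum_ambiguity_latticeSplit [NeZero d] (φ α β ψ : 𝓢(ι → ℝ, ℂ)) (r : ι → Fin d) :
    HasSum (fun a : (ι → ℤ) × (ι → ℤ) =>
      ambiguity φ ψ (ell d • intVec (latticeSplit ι d (r, a)).1)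
          (ell d • intVec (latticeSplit ι d (r, a)).2) *
        starRingEnd ℂ (ambiguity α β (ell d • intVec (latticeSplit ι d (r, a)).1)
          (ell d • intVec (latticeSplit ι d (r, a)).2)))
      ((((d * ell d) ^ (2 * Fintype.card ι) : ℝ) : ℂ) * ∫ x in unitBox ι,
        gkpDensity d φ α x * gkpDensity d β ψ (x - residueShift r)) := by
  have hd : 0 < d := Nat.pos_of_neZero d
  have hσ : 0 < d * ell d := mul_pos (Nat.cast_pos.2 hd) (ell_pos hd)
  set w := (d : ℝ)⁻¹ • intVec (residueVec r)
  have hparseval := (isWiener_dilate φ hσ).hasSum_ambiguity_mul_conj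
    (isWiener_dilate_comp_sub ψ hσ w) (isWiener_dilate α hσ) (isWiener_dilate_comp_sub β hσ w)
  have hswap : ∀ x, zakProd (dilate (d * ell d) φ) (fun y => dilate (d * ell d) ψ (y - w)) x *
        starRingEnd ℂ
          (zakProd (dilate (d * ell d) α) (fun y => dilate (d * ell d) β (y - w)) x) =
      gkpDensity d φ α x * gkpDensity d β ψ (x - residueShift r) := fun x => by
    rw [gkpDensity, gkpDensity, residueShift, ← zakProd_comp_sub]
    simp only [zakProd, map_mul, Complex.conj_conj]
    ring
  simp only [hswap] at hparseval
  refine (hparseval.mul_left _).congr_fun fun a => ?_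
  rw [ambiguity_latticeSplit, ambiguity_latticeSplit, map_mul, Complex.conj_ofReal,
    mul_mul_mul_comm, ← Complex.ofReal_mul, ← pow_add, ← two_mul]

theorem summable_ambiguity_mul_conj (φ α β ψ : 𝓢(ι → ℝ, ℂ)) {σ : ℝ} (hσ : 0 < σ) :
    Summable fun b : (ι → ℤ) × (ι → ℤ) => ambiguity φ ψ (σ • intVec b.1) (σ • intVec b.2) *
      starRingEnd ℂ (ambiguity α β (σ • intVec b.1) (σ • intVec b.2)) := by
  obtain ⟨C, hC⟩ := exists_norm_ambiguity_le α β
  refine ((summable_norm_ambiguity φ ψ hσ).mul_right C).of_norm_bounded fun b => ?_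
  rw [norm_mul, RCLike.norm_conj]
  exact mul_le_mul_of_nonneg_left (hC _ _) (norm_nonneg _)

theorem tsum_ambiguity_mul_conj {n : ℕ} (hd : 0 < d) (φ α β ψ : 𝓢(Fin n → ℝ, ℂ)) :
    ∑' b : Lattice n, ambiguity φ ψ (ell d • intVec b.1) (ell d • intVec b.2) *
        starRingEnd ℂ (ambiguity α β (ell d • intVec b.1) (ell d • intVec b.2)) =
      (2 * (Real.pi : ℂ)) ^ n * ∫ s, gkpForm d s φ α * gkpForm d s β ψ ∂cellMeasure n d := by
  have : NeZero d := ⟨hd.ne'⟩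
  have hl := ell_pos hd
  have hsum := (latticeSplit (Fin n) d).summable_iff.2 (summable_ambiguity_mul_conj φ α β ψ hl)
  have hconst : (((d * ell d) ^ (2 * n) : ℝ) : ℂ) *
      ((((d : ℝ) ^ n)⁻¹ * ell d ^ (2 * n) : ℝ) : ℂ) =
        (2 * (Real.pi : ℂ)) ^ n * ((ell d ^ (2 * n) : ℝ) : ℂ) := by
    have hpi : (2 * (Real.pi : ℂ)) ^ n = (((ell d * (d * ell d)) ^ n : ℝ) : ℂ) := by
      rw [ell_mul_period hd]
      push_cast
      rfl
    rw [hpi, ← Complex.ofReal_mul, ← Complex.ofReal_mul]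
    congr 1
    field_simp
    ring
  rw [← (latticeSplit (Fin n) d).tsum_eq]
  refine hsum.tsum_prod.trans ?_
  simp only [Function.comp_apply, (hasSum_ambiguity_latticeSplit φ α β ψ _).tsum_eq]
  rw [tsum_fintype, ← Finset.mul_sum, sum_setIntegral_gkpDensity_mul hd, Fintype.card_fin,
    ← mul_assoc, hconst, mul_assoc, cellMeasure, integral_smul_measure,
    ENNReal.toReal_ofReal (by positivity), Complex.real_smul]
  rfl

end Parseval

/-! ### The twirl -/

section Twirl

variable {n d : ℕ} {C D : Modes n →L[ℂ] Modes n}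

theorem HasWigner.summable_charFn_smul_disp (hC : HasWigner d C) :
    Summable fun a : Lattice n => charFn d C (-a) • disp d a.toPhase := by
  refine ((Equiv.neg (Lattice n)).summable_iff.2 hC.summable_norm_charFn).of_norm_bounded
    fun a => ?_
  rw [norm_smul]
  exact mul_le_of_le_one_right (norm_nonneg _) (norm_disp_le _)

/-- The expansion `(2π)⁻ⁿ ∑_a Tr (C T_{-a}) T_a` in integer displacements, which is the twirl
of `C`. -/
def twirlSeries (d : ℕ) (C : Modes n →L[ℂ] Modes n) : Modes n →L[ℂ] Modes n :=
  (1 / (2 * (Real.pi : ℂ)) ^ n) • ∑' a : Lattice n, charFn d C (-a) • disp d a.toPhase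

theorem HasWigner.hasSum_inner_charFn_smul_disp (hC : HasWigner d C) (φ ψ : Modes n) :
    HasSum (fun a : Lattice n => ⟪φ, disp d a.toPhase ψ⟫_ℂ * charFn d C (-a))
      ⟪φ, (∑' a : Lattice n, charFn d C (-a) • disp d a.toPhase) ψ⟫_ℂ := by
  refine ((hC.summable_charFn_smul_disp.hasSum.mapL
    (ContinuousLinearMap.apply ℂ (Modes n) ψ)).mapL (innerSL ℂ φ)).congr_fun fun a => ?_
  rw [ContinuousLinearMap.apply_apply, innerSL_apply_apply, smul_apply, inner_smul_right, mul_comm]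

theorem IsNuclearSum.hasSum_charFn {α β : ℕ → Modes n} (h : IsNuclearSum α β C) (a : Lattice n) :
    HasSum (fun i => ⟪β i, disp d a.toPhase (α i)⟫_ℂ) (charFn d C a) := by
  rw [charFn, ← IsTraceClass.trace_mul_comm h.isTraceClass]
  exact (h.comp_left (disp d a.toPhase)).hasSum_trace

theorem HasWigner.hasSum_inner_twirlSeries (hC : HasWigner d C) {α β : ℕ → Modes n}
    (h : IsNuclearSum α β C) {φ ψ : Modes n}
    (hφψ : Summable fun a : Lattice n => ‖⟪φ, disp d a.toPhase ψ⟫_ℂ‖) :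
    HasSum (fun i => 1 / (2 * (Real.pi : ℂ)) ^ n * ∑' a : Lattice n,
      ⟪φ, disp d a.toPhase ψ⟫_ℂ * ⟪β i, disp d (-a).toPhase (α i)⟫_ℂ)
      ⟪φ, twirlSeries d C ψ⟫_ℂ := by
  have hdouble : Summable fun p : ℕ × Lattice n =>
      ⟪φ, disp d p.2.toPhase ψ⟫_ℂ * ⟪β p.1, disp d (-p.2).toPhase (α p.1)⟫_ℂ := by
    refine (h.1.mul_of_nonneg hφψ (fun _ => by positivity) fun _ => by positivity).of_norm_bounded
      fun p => ?_
    rw [norm_mul, mul_comm]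
    gcongr
    refine (norm_inner_le_norm _ _).trans_eq ?_
    rw [norm_disp_apply, mul_comm]
  have hlattice := ((Equiv.prodComm _ _).symm.hasSum_iff.2 hdouble.hasSum).prod_fiberwise
    fun a => (h.hasSum_charFn (-a)).mul_left ⟪φ, disp d a.toPhase ψ⟫_ℂ
  have hexpansion := hdouble.hasSum.prod_fiberwise fun i => (hdouble.prod_factor i).hasSum
  rw [hlattice.unique (hC.hasSum_inner_charFn_smul_disp φ ψ)] at hexpansion
  rw [twirlSeries, smul_apply, inner_smul_right]
  exact hexpansion.mul_left _

theorem ambiguity_mul_conj_ambiguity (φ ψ α β : 𝓢(Fin n → ℝ, ℂ)) (a : Phase n) :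
    ambiguity φ ψ (ell d • a.1) (ell d • a.2) *
        starRingEnd ℂ (ambiguity α β (ell d • a.1) (ell d • a.2)) =
      ⟪φ.toLp 2 volume, disp d a (ψ.toLp 2 volume)⟫_ℂ *
        ⟪β.toLp 2 volume, disp d (-a) (α.toLp 2 volume)⟫_ℂ := by
  rw [← adjoint_disp, ContinuousLinearMap.adjoint_inner_right,
    ← inner_conj_symm (disp d a (β.toLp 2 volume)), inner_disp_toLp, inner_disp_toLp, map_mul,
    mul_mul_mul_comm, conj_phase, ← phase_add, add_neg_cancel, phase_zero, one_mul]

theorem integral_gkpForm_mul (hd : 0 < d) (φ α β ψ : 𝓢(Fin n → ℝ, ℂ)) :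
    ∫ s, gkpForm d s φ α * gkpForm d s β ψ ∂cellMeasure n d =
      1 / (2 * (Real.pi : ℂ)) ^ n * ∑' a : Lattice n,
        ⟪φ.toLp 2 volume, disp d a.toPhase (ψ.toLp 2 volume)⟫_ℂ *
          ⟪β.toLp 2 volume, disp d (-a).toPhase (α.toLp 2 volume)⟫_ℂ := by
  simp only [Lattice.toPhase_neg, ← ambiguity_mul_conj_ambiguity]
  rw [one_div, eq_inv_mul_iff_mul_eq₀ (two_pi_pow_ne_zero n)]
  exact (tsum_ambiguity_mul_conj hd φ α β ψ).symm

theorem HasWigner.isTwirl (hd : 0 < d) (hC : HasWigner d C) : IsTwirl d C (twirlSeries d C) := by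
  refine fun α β hsummable hsum φ ψ => ⟨fun i => integrable_gkpForm_mul hd φ (α i) (β i) ψ, ?_⟩
  simp only [integral_gkpForm_mul hd]
  exact hC.hasSum_inner_twirlSeries ⟨hsummable, hsum⟩ (summable_norm_inner_disp hd φ ψ)

theorem IsTwirl.unique {E E' : Modes n →L[ℂ] Modes n} (hC : IsTraceClass C) (h : IsTwirl d C E)
    (h' : IsTwirl d C E') : E = E' := by
  obtain ⟨α, β, hsummable, hsum⟩ := hC.exists_schwartz
  have hdense := denseRange_schwartz_toLp n
  refine ContinuousLinearMap.ext fun χ => congrFun (hdense.equalizer E.continuous E'.continuous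
    (funext fun ψ => hdense.eq_of_inner_right ℂ fun φ => ?_)) χ
  exact (h α β hsummable hsum φ ψ).2.unique (h' α β hsummable hsum φ ψ).2

theorem HasWigner.twirl_eq (hd : 0 < d) (hC : HasWigner d C) : twirl d C = twirlSeries d C := by
  have hexists : ∃ E, IsTwirl d C E := ⟨_, hC.isTwirl hd⟩
  rw [twirl, dif_pos hexists]
  exact IsTwirl.unique hC.isTraceClass (Classical.choose_spec hexists) (hC.isTwirl hd)

/-! ### Traces of twirled operators -/

theorem HasWigner.trace_twirlSeries_mul (hC : HasWigner d C) (hD : IsTraceClass D) :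
    trace (twirlSeries d C * D) = charPairing d C D := by
  have hseries := (hD.hasSum_trace_mul hC.summable_charFn_smul_disp.hasSum).tsum_eq
  simp only [smul_mul_assoc, trace_smul, hD.trace_mul_comm (disp d _)] at hseries
  rw [twirlSeries, smul_mul_assoc, trace_smul, ← hseries]
  rfl

/-- The trace per stabilizer `cellTrace` as a continuous linear functional, for exchanging it with
norm-convergent series of operators. -/
def cellTraceCLM (n d : ℕ) : (Modes n →L[ℂ] Modes n) →L[ℂ] ℂ :=
  ((2 * Real.pi / d : ℝ) : ℂ) ^ n • ∑ j : Fin n → Fin d,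
    (innerSL ℂ (cellVec d j)).comp (ContinuousLinearMap.apply ℂ (Modes n) (cellVec d j))

theorem cellTraceCLM_apply (X : Modes n →L[ℂ] Modes n) : cellTraceCLM n d X = cellTrace d X := by
  simp [cellTraceCLM, cellTrace]

theorem cellTrace_disp_mul_disp (hd : 0 < d) (a b : Lattice n) :
    cellTrace d (disp d a.toPhase * disp d b.toPhase) =
      if b = -a then (2 * (Real.pi : ℂ)) ^ n else 0 := by
  rw [disp_mul_disp, ← Lattice.toPhase_add, ← cellTraceCLM_apply, map_smul, cellTraceCLM_apply,
    cellTrace_disp hd, smul_eq_mul]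
  by_cases hab : b = -a
  · rw [if_pos hab, hab, add_neg_cancel, if_pos rfl, Lattice.toPhase_neg, symp_neg_right, symp_self,
      neg_zero, mul_zero, zero_div, neg_zero, phase_zero, one_mul]
  · rw [if_neg hab, if_neg (mt eq_neg_of_add_eq_zero_right hab), mul_zero]

theorem HasWigner.cellTrace_disp_mul_tsum (hd : 0 < d) (hD : HasWigner d D) (a : Lattice n) :
    cellTrace d (disp d a.toPhase * ∑' b : Lattice n, charFn d D (-b) • disp d b.toPhase) =
      (2 * (Real.pi : ℂ)) ^ n * charFn d D a := by
  have hseries := ((hD.summable_charFn_smul_disp.hasSum.mul_left (disp d a.toPhase)).mapL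
    (cellTraceCLM n d)).tsum_eq
  simp only [mul_smul_comm, map_smul, cellTraceCLM_apply, cellTrace_disp_mul_disp hd,
    smul_eq_mul] at hseries
  rw [← hseries, tsum_eq_single (-a) fun b hb => by rw [if_neg hb, mul_zero], if_pos rfl, neg_neg,
    mul_comm]

theorem HasWigner.cellTrace_twirlSeries_mul (hd : 0 < d) (hC : HasWigner d C)
    (hD : HasWigner d D) :
    cellTrace d (twirlSeries d C * twirlSeries d D) = charPairing d C D := by
  have hseries := ((hC.summable_charFn_smul_disp.hasSum.mul_right
    (∑' b : Lattice n, charFn d D (-b) • disp d b.toPhase)).mapL (cellTraceCLM n d)).tsum_eq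
  simp only [smul_mul_assoc, map_smul, cellTraceCLM_apply, hD.cellTrace_disp_mul_tsum hd,
    smul_eq_mul, mul_left_comm (charFn d C _)] at hseries
  rw [twirlSeries, twirlSeries, smul_mul_smul_comm, ← cellTraceCLM_apply, map_smul,
    cellTraceCLM_apply, ← hseries, tsum_mul_left, smul_eq_mul, mul_assoc,
    ← mul_assoc (1 / _) (_ ^ n), one_div_mul_cancel (two_pi_pow_ne_zero n), one_mul, charPairing]

end Twirl

end ZakGross

end

open ZakGross in
theorem lemma2_general (n d : ℕ) (hd : 0 < d) :
    (∀ C D : Modes n →L[ℂ] Modes n, HasWigner d C → HasWigner d D →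
      HasWigner d (C + D) ∧ ∀ η, wigner d (C + D) η = wigner d C η + wigner d D η) ∧
    (∀ (c : ℂ) (C : Modes n →L[ℂ] Modes n), HasWigner d C →
      HasWigner d (c • C) ∧ ∀ η, wigner d (c • C) η = c * wigner d C η) ∧
    (∀ C : Modes n →L[ℂ] Modes n, HasWigner d C →
      HasWigner d (ContinuousLinearMap.adjoint C) ∧
      ∀ η, wigner d (ContinuousLinearMap.adjoint C) η = starRingEnd ℂ (wigner d C η)) ∧
    (∀ C : Modes n →L[ℂ] Modes n, HasWigner d C →
      Integrable (wigner d C) (torusMeasure n d) ∧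
      ∫ η, wigner d C η ∂torusMeasure n d = trace C) ∧
    (∀ C : Modes n →L[ℂ] Modes n, HasWigner d C → ∀ b : Phase n,
      HasWigner d (disp d b * C * ContinuousLinearMap.adjoint (disp d b)) ∧
      ∀ η, wigner d (disp d b * C * ContinuousLinearMap.adjoint (disp d b)) η =
        wigner d C (η - ell d • b)) ∧
    (∀ C D : Modes n →L[ℂ] Modes n, HasWigner d C → HasWigner d D →
      IsTwirl d C (twirl d C) ∧ IsTwirl d D (twirl d D) ∧
      IsTraceClass (twirl d C * D) ∧ IsTraceClass (C * twirl d D) ∧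
      Integrable (fun η => wigner d C η * wigner d D η) (torusMeasure n d) ∧
      ∫ η, wigner d C η * wigner d D η ∂torusMeasure n d = trace (twirl d C * D) ∧
      trace (twirl d C * D) = trace (C * twirl d D) ∧
      trace (C * twirl d D) = cellTrace d (twirl d C * twirl d D)) := by
  refine ⟨fun C D hC hD => ⟨hC.add hD, wigner_add hC hD⟩,
    fun c C hC => ⟨hC.smul c, wigner_smul c C⟩,
    fun C hC => ⟨hC.adjoint, wigner_adjoint hC.isTraceClass⟩,
    fun C hC => ⟨hC.integrable_wigner, hC.integral_wigner hd⟩,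
    fun C hC b => ⟨hC.disp_conj b, wigner_disp_conj hC.isTraceClass b⟩, fun C D hC hD => ?_⟩
  have htrace_left : trace (twirl d C * D) = charPairing d C D := by
    rw [hC.twirl_eq hd, hC.trace_twirlSeries_mul hD.isTraceClass]
  have htrace_right : trace (C * twirl d D) = charPairing d C D := by
    rw [hD.twirl_eq hd, ← hC.isTraceClass.trace_mul_comm, hD.trace_twirlSeries_mul hC.isTraceClass,
      charPairing_comm]
  have hcellTrace : cellTrace d (twirl d C * twirl d D) = charPairing d C D := by
    rw [hC.twirl_eq hd, hD.twirl_eq hd, hC.cellTrace_twirlSeries_mul hd hD]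
  exact ⟨hC.twirl_eq hd ▸ hC.isTwirl hd, hD.twirl_eq hd ▸ hD.isTwirl hd,
    hD.isTraceClass.mul_left _, hC.isTraceClass.mul_right _, hC.integrable_wigner_mul hD,
    (hC.integral_wigner_mul hd hD).trans htrace_left.symm, htrace_left.trans htrace_right.symm,
    htrace_right.trans hcellTrace.symm⟩

theorem lemma2 (n d : ℕ) (hd : Odd d) :
    -- linearity
    (∀ C D : ZakGross.Modes n →L[ℂ] ZakGross.Modes n,
      ZakGross.HasWigner d C → ZakGross.HasWigner d D →
        ZakGross.HasWigner d (C + D) ∧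
        ∀ η, ZakGross.wigner d (C + D) η = ZakGross.wigner d C η + ZakGross.wigner d D η) ∧
    (∀ (c : ℂ) (C : ZakGross.Modes n →L[ℂ] ZakGross.Modes n), ZakGross.HasWigner d C →
        ZakGross.HasWigner d (c • C) ∧
        ∀ η, ZakGross.wigner d (c • C) η = c * ZakGross.wigner d C η) ∧
    -- reality
    (∀ C : ZakGross.Modes n →L[ℂ] ZakGross.Modes n, ZakGross.HasWigner d C →
        ZakGross.HasWigner d (ContinuousLinearMap.adjoint C) ∧
        ∀ η, ZakGross.wigner d (ContinuousLinearMap.adjoint C) η =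
          starRingEnd ℂ (ZakGross.wigner d C η)) ∧
    -- standardization
    (∀ C : ZakGross.Modes n →L[ℂ] ZakGross.Modes n, ZakGross.HasWigner d C →
        MeasureTheory.Integrable (ZakGross.wigner d C) (ZakGross.torusMeasure n d) ∧
        ∫ η, ZakGross.wigner d C η ∂ZakGross.torusMeasure n d = ZakGross.trace C) ∧
    -- covariance under all real displacements
    (∀ C : ZakGross.Modes n →L[ℂ] ZakGross.Modes n, ZakGross.HasWigner d C →
      ∀ b : ZakGross.Phase n,
        ZakGross.HasWigner d
          (ZakGross.disp d b * C * ContinuousLinearMap.adjoint (ZakGross.disp d b)) ∧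
        ∀ η, ZakGross.wigner d
            (ZakGross.disp d b * C * ContinuousLinearMap.adjoint (ZakGross.disp d b)) η =
          ZakGross.wigner d C (η - ZakGross.ell d • b)) ∧
    -- traciality
    (∀ C D : ZakGross.Modes n →L[ℂ] ZakGross.Modes n,
      ZakGross.HasWigner d C → ZakGross.HasWigner d D →
        ZakGross.IsTwirl d C (ZakGross.twirl d C) ∧
        ZakGross.IsTwirl d D (ZakGross.twirl d D) ∧
        ZakGross.IsTraceClass (ZakGross.twirl d C * D) ∧
        ZakGross.IsTraceClass (C * ZakGross.twirl d D) ∧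
        MeasureTheory.Integrable (fun η => ZakGross.wigner d C η * ZakGross.wigner d D η)
          (ZakGross.torusMeasure n d) ∧
        ∫ η, ZakGross.wigner d C η * ZakGross.wigner d D η ∂ZakGross.torusMeasure n d =
          ZakGross.trace (ZakGross.twirl d C * D) ∧
        ZakGross.trace (ZakGross.twirl d C * D) = ZakGross.trace (C * ZakGross.twirl d D) ∧
        ZakGross.trace (C * ZakGross.twirl d D) =
          ZakGross.cellTrace d (ZakGross.twirl d C * ZakGross.twirl d D)) :=
  lemma2_general n d hd.pos
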